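/- Let $d\ge 1$, let $\Omega\subseteq\mathbb{R}^d$ be a non-empty open set, and let $(M_p)_{p\in\mathbb{N}}$ be a sequence of positive numbers with $M_0=1$ such that * $(M.1)$ $M_p^2\le M_{p-1}M_{p+1}$ for $p\ge 1$; * $(M.2)$ there are $A,H\ge 1$ with $M_{p+q}\le AH^{p+q}M_pM_q$ for all $p,q\in\mathbb{N}$; * $(M.3)'$ $\sum_{p\ge 1} M_{p-1}/M_p<\infty$. For a positive sequence $(N_p)$, a compact set $K\subset\Omega$ and $h>0$ put $\|\varphi\|_{N,h,K}=\sup_{x\in K,\ \alpha\in\mathbb{N}^d}|\partial^\alpha\varphi(x)|/(h^{|\alpha|}N_{|\alpha|})$. Let $\mathcal{E}^{(N_p)}(\Omega)$ (Beurling case), respectively $\mathcal{E}^{\{N_p\}}(\Omega)$ (Roumieu case), be the space of all $\varphi\in C^\infty(\Omega)$ such that for every compact $K\subset\Omega$ one has $\|\varphi\|_{N,h,K}<\infty$ for every $h>0$, respectively for some $h>0$. Let $\ast$ be $(M_p)$ or $\{M_p\}$. Let $\mathcal{D}^\ast(\Omega)$ be the space of compactly supported elements of $\mathcal{E}^\ast(\Omega)$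 with its usual locally convex topology, and ${\mathcal{D}^\ast}'(\Omega)$ its dual: a linear functional $u$ on $\mathcal{D}^\ast(\Omega)$ belongs to it if and only if for every compact $K\subset\Omega$ there is for some $h>0$ (Beurling case), respectively for every $h>0$ (Roumieu case), a constant $C$ with $|u(\varphi)|\le C\|\varphi\|_{M,h,K}$ for all $\varphi\in\mathcal{D}^\ast(\Omega)$ with support in $K$ and $\|\varphi\|_{M,h,K}<\infty$. Continuous functions $g$ on $\Omega$ are regarded as elements of ${\mathcal{D}^\ast}'(\Omega)$ via $\varphi\mapsto\int_\Omega g\varphi\,dx$. A $\ast$-ultradifferential operator is $P(D)=\sum_{\alpha\in\mathbb{N}^d}a_\alpha D^\alpha$, where $D=-i\partial$, $a_\alpha\in\mathbb{C}$, and $|a_\alpha|\le CL^{|\alpha|}/M_{|\alpha|}$ for all $\alpha$ for some $L,C>0$ (Beurling case), respectively for every $L>0$ with some $C=C_L>0$ (Roumieu case); it acts on ${\mathcal{D}^\ast}'(\Omega)$ by $\langle P(D)u,\varphi\rangle=\langle u,P(-D)\varphi\rangle$. Its symbol is $P(\xi)=\sum_\alpha a_\alpha\xi^\alpha$, and $(\partial^\beta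 P)(D)$ is the operator with symbol $\partial^\beta_\xi P$. Let $\dagger$ be $(N_p)$ or $\{N_p\}$ for a positive sequence $(N_p)$. Consider the following properties of an associative and commutative algebra $(\mathcal{A}^{\ast,\dagger}(\Omega),+,\circ)$ over $\mathbb{C}$. * $(P.1)$ ${\mathcal{D}^\ast}'(\Omega)$ is linearly embedded into $\mathcal{A}^{\ast,\dagger}(\Omega)$, and the constant function $1$ is the unity of $\mathcal{A}^{\ast,\dagger}(\Omega)$. * $(P.2)$ For each $\ast$-ultradifferential operator $P(D)$ there is a linear operator $P(D):\mathcal{A}^{\ast,\dagger}(\Omega)\to\mathcal{A}^{\ast,\dagger}(\Omega)$ which coincides on ${\mathcal{D}^\ast}'(\Omega)$ with the usual action of $P(D)$, such that for every $f\in\mathcal{A}^{\ast,\dagger}(\Omega)$ and every polynomial $q$ $$P(D)(q\circ f)=\sum_{|\beta|\le\deg q}\frac{1}{\beta!}\,D^\beta q\circ(\partial^\beta P)(D)f .$$ * $(P.3)$ For $f,g\in\mathcal{E}^\dagger(\Omega)$ the product $f\circ g$ is the pointwise product $fg$. Then: 1. Suppose that $(N_p)$ satisfies $(M.1)$ and $(M.2)'$: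 there are $A,H\ge 1$ with $N_{p+1}\le AH^pN_p$ for all $p$; and that $M_p\prec N_p$, that is, for every $l>0$ there is $C>0$ with $M_p\le Cl^pN_p$ for all $p$. Then for each of the two choices of $\ast$ and each of the two choices of $\dagger$ there is no associative and commutative algebra $\mathcal{A}^{\ast,\dagger}(\Omega)$ satisfying $(P.1)$--$(P.3)$. 2. There is no associative and commutative algebra $\mathcal{A}^{(M_p),\{M_p\}}(\Omega)$ satisfying $(P.1)$--$(P.3)$ with $\ast=(M_p)$ and $\dagger=\{M_p\}$. -/

import Mathlib

open scoped ContDiff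

universe u

noncomputable section

namespace UltraImposs

/-! ### Weight sequences -/

/-- `(M.1)`: logarithmic convexity, `M_p ^ 2 ≤ M_{p-1} M_{p+1}` for `p ≥ 1`. -/
def CondM1 (M : ℕ → ℝ) : Prop :=
  ∀ p, M (p + 1) ^ 2 ≤ M p * M (p + 2)

/-- `(M.2)`: stability under ultradifferential operators. -/
def CondM2 (M : ℕ → ℝ) : Prop :=
  ∃ A H : ℝ, 1 ≤ A ∧ 1 ≤ H ∧ ∀ p q, M (p + q) ≤ A * H ^ (p + q) * M p * M q

/-- `(M.2)'`: stability under differential operators. -/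
def CondM2' (M : ℕ → ℝ) : Prop :=
  ∃ A H : ℝ, 1 ≤ A ∧ 1 ≤ H ∧ ∀ p, M (p + 1) ≤ A * H ^ p * M p

/-- `(M.3)'`: non-quasianalyticity, `∑_{p ≥ 1} M_{p-1} / M_p < ∞`. -/
def CondM3' (M : ℕ → ℝ) : Prop :=
  Summable fun p => M p / M (p + 1)

/-- `M_p ≺ N_p`: for every `l > 0` there is `C > 0` with `M_p ≤ C l ^ p N_p` for all `p`. -/
def Prec (M N : ℕ → ℝ) : Prop :=
  ∀ l : ℝ, 0 < l → ∃ C : ℝ, 0 < C ∧ ∀ p, M p ≤ C * l ^ p * N p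

/-- The two types of classes: Beurling `(M_p)` and Roumieu `{M_p}`. -/
inductive Kind
  | beurling
  | roumieu

variable {d : ℕ}

/-! ### Partial derivatives -/

/-- The partial derivative `∂_i`. -/
def pd (i : Fin d) (f : EuclideanSpace ℝ (Fin d) → ℂ) : EuclideanSpace ℝ (Fin d) → ℂ :=
  fun x => fderiv ℝ f x (EuclideanSpace.single i 1)

/-- The iterated partial derivative `∂_{i_1}^{α_{i_1}} ∂_{i_2}^{α_{i_2}} ⋯` along a list. -/
def pdList (α : Fin d →₀ ℕ) (l : List (Fin d)) (f : EuclideanSpace ℝ (Fin d) → ℂ) :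
    EuclideanSpace ℝ (Fin d) → ℂ :=
  l.foldr (fun i g => (pd i)^[α i] g) f

/-- The partial derivative `∂^α` for a multi-index `α`. -/
def mpd (α : Fin d →₀ ℕ) (f : EuclideanSpace ℝ (Fin d) → ℂ) :
    EuclideanSpace ℝ (Fin d) → ℂ :=
  pdList α (List.finRange d) f

/-! ### Ultradifferentiable functions -/

/-- `‖f‖_{E^{{M_p},h}(K)} ≤ B`, that is, `|∂^α f(x)| ≤ B h^{|α|} M_{|α|}` for all `x ∈ K` and all
multi-indices `α`. -/
def NormLE (M : ℕ → ℝ) (h : ℝ) (K : Set (EuclideanSpace ℝ (Fin d)))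
    (f : EuclideanSpace ℝ (Fin d) → ℂ) (B : ℝ) : Prop :=
  ∀ x ∈ K, ∀ α : Fin d →₀ ℕ, ‖mpd α f x‖ ≤ B * (h ^ α.degree * M α.degree)

/-- The norm in `E^{{M_p},h}(K)` is finite for every `h > 0` (Beurling), respectively for some
`h > 0` (Roumieu). -/
def BoundedOn (k : Kind) (M : ℕ → ℝ) (K : Set (EuclideanSpace ℝ (Fin d)))
    (f : EuclideanSpace ℝ (Fin d) → ℂ) : Prop :=
  match k with
  | .beurling => ∀ h : ℝ, 0 < h → ∃ B : ℝ, 0 ≤ B ∧ NormLE M h K f B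
  | .roumieu => ∃ h : ℝ, 0 < h ∧ ∃ B : ℝ, 0 ≤ B ∧ NormLE M h K f B

/-- `f ∈ E^*(Ω)`, where `*` is `(M_p)` or `{M_p}`. The values of `f` outside `Ω` play no role. -/
def IsUltraDiff (k : Kind) (M : ℕ → ℝ) (Ω : TopologicalSpace.Opens (EuclideanSpace ℝ (Fin d)))
    (f : EuclideanSpace ℝ (Fin d) → ℂ) : Prop :=
  ContDiffOn ℝ ∞ f Ω ∧
    ∀ K : Set (EuclideanSpace ℝ (Fin d)), IsCompact K → K ⊆ Ω → BoundedOn k M K f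

section Linearity

variable {Ω : TopologicalSpace.Opens (EuclideanSpace ℝ (Fin d))}
  {f g : EuclideanSpace ℝ (Fin d) → ℂ}

theorem contDiffOn_pd (i : Fin d) (hf : ContDiffOn ℝ ∞ f Ω) : ContDiffOn ℝ ∞ (pd i f) Ω :=
  (hf.fderiv_of_isOpen Ω.isOpen (m := ∞) (by simp)).clm_apply contDiffOn_const

theorem pd_congr (i : Fin d) (h : Set.EqOn f g Ω) : Set.EqOn (pd i f) (pd i g) Ω := by
  intro x hx
  have : f =ᶠ[nhds x] g := h.eventuallyEq_of_mem (Ω.isOpen.mem_nhds hx)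
  simp only [pd, this.fderiv_eq]

theorem pd_add (i : Fin d) (hf : ContDiffOn ℝ ∞ f Ω) (hg : ContDiffOn ℝ ∞ g Ω) :
    Set.EqOn (pd i (f + g)) (pd i f + pd i g) Ω := by
  intro x hx
  have hf' := (hf.contDiffAt (Ω.isOpen.mem_nhds hx)).differentiableAt (by simp)
  have hg' := (hg.contDiffAt (Ω.isOpen.mem_nhds hx)).differentiableAt (by simp)
  simp [pd, fderiv_add hf' hg']

theorem pd_smul (i : Fin d) (c : ℂ) (hf : ContDiffOn ℝ ∞ f Ω) :
    Set.EqOn (pd i (c • f)) (c • pd i f) Ω := by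
  intro x hx
  have hf' := (hf.contDiffAt (Ω.isOpen.mem_nhds hx)).differentiableAt (by simp)
  simp [pd, fderiv_const_smul hf' c]

theorem pdIter_add (i : Fin d) (n : ℕ) (hf : ContDiffOn ℝ ∞ f Ω) (hg : ContDiffOn ℝ ∞ g Ω) :
    ContDiffOn ℝ ∞ ((pd i)^[n] f) Ω ∧
      Set.EqOn ((pd i)^[n] (f + g)) ((pd i)^[n] f + (pd i)^[n] g) Ω := by
  induction n generalizing f g with
  | zero => exact ⟨hf, fun x _ => rfl⟩
  | succ n ih =>
    refine ⟨?_, ?_⟩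
    · exact (ih (contDiffOn_pd i hf) (contDiffOn_pd i hg)).1
    · rw [Function.iterate_succ_apply', Function.iterate_succ_apply',
        Function.iterate_succ_apply']
      exact (pd_congr i (ih hf hg).2).trans (pd_add i (ih hf hg).1 (ih hg hf).1)

theorem pdIter_congr (i : Fin d) (n : ℕ) (h : Set.EqOn f g Ω) :
    Set.EqOn ((pd i)^[n] f) ((pd i)^[n] g) Ω := by
  induction n generalizing f g with
  | zero => exact h
  | succ n ih => exact ih (pd_congr i h)

theorem pdIter_smul (i : Fin d) (n : ℕ) (c : ℂ) (hf : ContDiffOn ℝ ∞ f Ω) :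
    Set.EqOn ((pd i)^[n] (c • f)) (c • (pd i)^[n] f) Ω := by
  induction n generalizing f with
  | zero => exact fun x _ => rfl
  | succ n ih =>
    rw [Function.iterate_succ_apply', Function.iterate_succ_apply']
    exact (pd_congr i (ih hf)).trans (pd_smul i c (pdIter_add i n hf hf).1)

theorem contDiffOn_pdList (α : Fin d →₀ ℕ) (l : List (Fin d)) (hf : ContDiffOn ℝ ∞ f Ω) :
    ContDiffOn ℝ ∞ (pdList α l f) Ω := by
  induction l with
  | nil => exact hf
  | cons i l ih => exact (pdIter_add i (α i) ih ih).1

theorem pdList_add (α : Fin d →₀ ℕ) (l : List (Fin d))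
    (hf : ContDiffOn ℝ ∞ f Ω) (hg : ContDiffOn ℝ ∞ g Ω) :
    Set.EqOn (pdList α l (f + g)) (pdList α l f + pdList α l g) Ω := by
  induction l with
  | nil => exact fun x _ => rfl
  | cons i l ih =>
    exact (pdIter_congr i (α i) ih).trans
      (pdIter_add i (α i) (contDiffOn_pdList α l hf) (contDiffOn_pdList α l hg)).2

theorem pdList_smul (α : Fin d →₀ ℕ) (l : List (Fin d)) (c : ℂ) (hf : ContDiffOn ℝ ∞ f Ω) :
    Set.EqOn (pdList α l (c • f)) (c • pdList α l f) Ω := by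
  induction l with
  | nil => exact fun x _ => rfl
  | cons i l ih =>
    exact (pdIter_congr i (α i) ih).trans (pdIter_smul i (α i) c (contDiffOn_pdList α l hf))

theorem pdIter_zero (i : Fin d) (n : ℕ) :
    (pd i)^[n] (0 : EuclideanSpace ℝ (Fin d) → ℂ) = 0 := by
  induction n with
  | zero => rfl
  | succ n ih =>
    rw [Function.iterate_succ_apply', ih]
    funext x
    simp [pd]

theorem mpd_zero (α : Fin d →₀ ℕ) : mpd α (0 : EuclideanSpace ℝ (Fin d) → ℂ) = 0 := by
  unfold mpd
  induction List.finRange d with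
  | nil => rfl
  | cons i l ih =>
    change (pd i)^[α i] (pdList α l 0) = 0
    rw [ih, pdIter_zero]

theorem mpd_index_zero (f : EuclideanSpace ℝ (Fin d) → ℂ) : mpd 0 f = f := by
  unfold mpd
  induction List.finRange d with
  | nil => rfl
  | cons i l ih => exact ih

theorem NormLE.add {M : ℕ → ℝ} {h : ℝ} {K : Set (EuclideanSpace ℝ (Fin d))} {B C : ℝ}
    (hK : K ⊆ Ω) (hf : ContDiffOn ℝ ∞ f Ω) (hg : ContDiffOn ℝ ∞ g Ω)
    (h1 : NormLE M h K f B) (h2 : NormLE M h K g C) : NormLE M h K (f + g) (B + C) := by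
  intro x hx α
  have e : mpd α (f + g) x = mpd α f x + mpd α g x := pdList_add α _ hf hg (hK hx)
  rw [e, add_mul]
  exact (norm_add_le _ _).trans (add_le_add (h1 x hx α) (h2 x hx α))

theorem NormLE.smul {M : ℕ → ℝ} {h : ℝ} {K : Set (EuclideanSpace ℝ (Fin d))} {B : ℝ} (c : ℂ)
    (hK : K ⊆ Ω) (hf : ContDiffOn ℝ ∞ f Ω)
    (h1 : NormLE M h K f B) : NormLE M h K (c • f) (‖c‖ * B) := by
  intro x hx α
  have e : mpd α (c • f) x = c * mpd α f x := pdList_smul α _ c hf (hK hx)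
  rw [e, norm_mul, mul_assoc]
  exact mul_le_mul_of_nonneg_left (h1 x hx α) (norm_nonneg c)

theorem NormLE.mono {M : ℕ → ℝ} (hM : ∀ p, 0 < M p) {h h' : ℝ} (h0 : 0 < h) (hh : h ≤ h')
    {K : Set (EuclideanSpace ℝ (Fin d))} {B : ℝ} (hB : 0 ≤ B)
    (h1 : NormLE M h K f B) : NormLE M h' K f B := by
  intro x hx α
  refine (h1 x hx α).trans (mul_le_mul_of_nonneg_left ?_ hB)
  exact mul_le_mul_of_nonneg_right (pow_le_pow_left₀ h0.le hh _) (hM _).le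

theorem IsUltraDiff.zero {k : Kind} {M : ℕ → ℝ} :
    IsUltraDiff k M Ω 0 := by
  have key : ∀ (h : ℝ) (K : Set (EuclideanSpace ℝ (Fin d))), 0 < h → NormLE M h K 0 0 := by
    intro h K _ x _ α
    simp [mpd_zero]
  refine ⟨contDiffOn_const, fun K _ _ => ?_⟩
  cases k with
  | beurling => exact fun h h0 => ⟨0, le_rfl, key h K h0⟩
  | roumieu => exact ⟨1, one_pos, 0, le_rfl, key 1 K one_pos⟩

theorem IsUltraDiff.add {k : Kind} {M : ℕ → ℝ} (hM : ∀ p, 0 < M p)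
    (hf : IsUltraDiff k M Ω f) (hg : IsUltraDiff k M Ω g) : IsUltraDiff k M Ω (f + g) := by
  refine ⟨hf.1.add hg.1, fun K hK hKΩ => ?_⟩
  have h1 := hf.2 K hK hKΩ
  have h2 := hg.2 K hK hKΩ
  cases k with
  | beurling =>
    intro h h0
    obtain ⟨B, hB, hfB⟩ := h1 h h0
    obtain ⟨C, hC, hgC⟩ := h2 h h0
    exact ⟨B + C, add_nonneg hB hC, hfB.add hKΩ hf.1 hg.1 hgC⟩
  | roumieu =>
    obtain ⟨h, h0, B, hB, hfB⟩ := h1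
    obtain ⟨h', h0', C, hC, hgC⟩ := h2
    exact ⟨max h h', lt_max_of_lt_left h0, B + C, add_nonneg hB hC,
      (hfB.mono hM h0 (le_max_left _ _) hB).add hKΩ hf.1 hg.1
        (hgC.mono hM h0' (le_max_right _ _) hC)⟩

theorem IsUltraDiff.smul {k : Kind} {M : ℕ → ℝ} (c : ℂ)
    (hf : IsUltraDiff k M Ω f) : IsUltraDiff k M Ω (c • f) := by
  refine ⟨contDiffOn_const.smul hf.1, fun K hK hKΩ => ?_⟩
  have h1 := hf.2 K hK hKΩ
  cases k with
  | beurling =>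
    intro h h0
    obtain ⟨B, hB, hfB⟩ := h1 h h0
    exact ⟨‖c‖ * B, by positivity, hfB.smul c hKΩ hf.1⟩
  | roumieu =>
    obtain ⟨h, h0, B, hB, hfB⟩ := h1
    exact ⟨h, h0, ‖c‖ * B, by positivity, hfB.smul c hKΩ hf.1⟩

end Linearity



/-- A positive weight sequence. -/
abbrev PosSeq : Type := {M : ℕ → ℝ // ∀ p, 0 < M p}

/-! ### Test functions and ultradistributions -/

/-- The test space `D^*(Ω)`: elements of `E^*(Ω)` with compact support contained in `Ω`
(extended by `0` to the whole space). -/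
def TestSpace (k : Kind) (M : PosSeq)
    (Ω : TopologicalSpace.Opens (EuclideanSpace ℝ (Fin d))) :
    Submodule ℂ (EuclideanSpace ℝ (Fin d) → ℂ) where
  carrier := {φ | IsUltraDiff k M.1 Ω φ ∧ HasCompactSupport φ ∧ tsupport φ ⊆ Ω}
  zero_mem' := ⟨IsUltraDiff.zero, HasCompactSupport.zero, by simp [tsupport]⟩
  add_mem' := fun {f g} hf hg => ⟨hf.1.add M.2 hg.1, hf.2.1.add hg.2.1,
    (tsupport_add f g).trans (Set.union_subset hf.2.2 hg.2.2)⟩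
  smul_mem' := fun c f hf => ⟨hf.1.smul c,
    hf.2.1.mono (Function.support_const_smul_subset c f),
    (closure_mono (Function.support_const_smul_subset c f)).trans hf.2.2⟩

/-- `|u(φ)| ≤ C ‖φ‖_{E^{{M_p},h}(K)}` for all `φ ∈ D^*(Ω)` supported in `K` for which the norm on
the right is finite. -/
def DualBound {k : Kind} {M : PosSeq}
    {Ω : TopologicalSpace.Opens (EuclideanSpace ℝ (Fin d))}
    (u : TestSpace k M Ω →ₗ[ℂ] ℂ) (K : Set (EuclideanSpace ℝ (Fin d))) (h C : ℝ) : Prop :=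
  ∀ φ : TestSpace k M Ω, tsupport φ.1 ⊆ K → ∀ B : ℝ, 0 ≤ B → NormLE M.1 h K φ.1 B →
    ‖u φ‖ ≤ C * B

/-- Continuity of a linear functional on `D^*(Ω)`.
`D^*(Ω)` is the locally convex inductive limit over `K ⋐ Ω` of the spaces `D^*(K)`, so that
continuity means continuity on each `D^*(K)`; and `D^{(M_p)}(K)` (respectively `D^{{M_p}}(K)`) is
the projective limit as `h → 0` (respectively the inductive limit as `h → ∞`) of the normed spaces
`D^{{M_p},h}(K)`, so that continuity there is an estimate for some `h` (respectively for all
`h`). -/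
def IsCont {k : Kind} {M : PosSeq}
    {Ω : TopologicalSpace.Opens (EuclideanSpace ℝ (Fin d))}
    (u : TestSpace k M Ω →ₗ[ℂ] ℂ) : Prop :=
  ∀ K : Set (EuclideanSpace ℝ (Fin d)), IsCompact K → K ⊆ Ω →
    match k with
    | .beurling => ∃ h : ℝ, 0 < h ∧ ∃ C : ℝ, 0 ≤ C ∧ DualBound u K h C
    | .roumieu => ∀ h : ℝ, 0 < h → ∃ C : ℝ, 0 ≤ C ∧ DualBound u K h C

section Dual

variable {k : Kind} {M : PosSeq} {Ω : TopologicalSpace.Opens (EuclideanSpace ℝ (Fin d))}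

theorem DualBound.add {u v : TestSpace k M Ω →ₗ[ℂ] ℂ} {K : Set (EuclideanSpace ℝ (Fin d))}
    {h C C' : ℝ} (hu : DualBound u K h C) (hv : DualBound v K h C') :
    DualBound (u + v) K h (C + C') := by
  intro φ hφ B hB hn
  rw [LinearMap.add_apply, add_mul]
  exact (norm_add_le _ _).trans (add_le_add (hu φ hφ B hB hn) (hv φ hφ B hB hn))

theorem DualBound.smul {u : TestSpace k M Ω →ₗ[ℂ] ℂ} {K : Set (EuclideanSpace ℝ (Fin d))}
    {h C : ℝ} (c : ℂ) (hu : DualBound u K h C) : DualBound (c • u) K h (‖c‖ * C) := by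
  intro φ hφ B hB hn
  rw [LinearMap.smul_apply, smul_eq_mul, norm_mul, mul_assoc]
  exact mul_le_mul_of_nonneg_left (hu φ hφ B hB hn) (norm_nonneg c)

theorem DualBound.anti {u : TestSpace k M Ω →ₗ[ℂ] ℂ} {K : Set (EuclideanSpace ℝ (Fin d))}
    {h h' C : ℝ} (h0 : 0 < h') (hh : h' ≤ h) (hu : DualBound u K h C) : DualBound u K h' C :=
  fun φ hφ B hB hn => hu φ hφ B hB (hn.mono M.2 h0 hh hB)

end Dual

/-- The space `D^*'(Ω)` of ultradistributions on `Ω`, the dual of `D^*(Ω)`. -/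
def UltraDistr (k : Kind) (M : PosSeq)
    (Ω : TopologicalSpace.Opens (EuclideanSpace ℝ (Fin d))) :
    Submodule ℂ (TestSpace k M Ω →ₗ[ℂ] ℂ) where
  carrier := {u | IsCont u}
  zero_mem' := by
    have key : ∀ K h, DualBound (0 : TestSpace k M Ω →ₗ[ℂ] ℂ) K h 0 := by
      intro K h φ _ B _ _
      simp
    intro K _ _
    cases k with
    | beurling => exact ⟨1, one_pos, 0, le_rfl, key K 1⟩
    | roumieu => exact fun h _ => ⟨0, le_rfl, key K h⟩
  add_mem' := by
    intro u v hu hv K hK hKΩ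
    have h1 := hu K hK hKΩ
    have h2 := hv K hK hKΩ
    cases k with
    | beurling =>
      obtain ⟨h, h0, C, hC, hb⟩ := h1
      obtain ⟨h', h0', C', hC', hb'⟩ := h2
      exact ⟨min h h', lt_min h0 h0', C + C', add_nonneg hC hC',
        (hb.anti (lt_min h0 h0') (min_le_left _ _)).add
          (hb'.anti (lt_min h0 h0') (min_le_right _ _))⟩
    | roumieu =>
      intro h h0
      obtain ⟨C, hC, hb⟩ := h1 h h0
      obtain ⟨C', hC', hb'⟩ := h2 h h0
      exact ⟨C + C', add_nonneg hC hC', hb.add hb'⟩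
  smul_mem' := by
    intro c u hu K hK hKΩ
    have h1 := hu K hK hKΩ
    cases k with
    | beurling =>
      obtain ⟨h, h0, C, hC, hb⟩ := h1
      exact ⟨h, h0, ‖c‖ * C, by positivity, hb.smul c⟩
    | roumieu =>
      intro h h0
      obtain ⟨C, hC, hb⟩ := h1 h h0
      exact ⟨‖c‖ * C, by positivity, hb.smul c⟩

section Functions

variable {k : Kind} {M : PosSeq} {Ω : TopologicalSpace.Opens (EuclideanSpace ℝ (Fin d))}

theorem integrableOn_mul_test {g : EuclideanSpace ℝ (Fin d) → ℂ} (hg : ContinuousOn g Ω)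
    (φ : TestSpace k M Ω) : MeasureTheory.IntegrableOn (fun x => g x * φ.1 x) Ω := by
  have hφ := φ.2
  have hK : IsCompact (tsupport φ.1) := hφ.2.1
  have hKΩ : tsupport φ.1 ⊆ Ω := hφ.2.2
  have hc : ContinuousOn (fun x => g x * φ.1 x) (tsupport φ.1) :=
    (hg.mul hφ.1.1.continuousOn).mono hKΩ
  have hi : MeasureTheory.IntegrableOn (fun x => g x * φ.1 x) (tsupport φ.1) :=
    hc.integrableOn_compact hK
  refine MeasureTheory.Integrable.integrableOn ?_
  refine (MeasureTheory.integrableOn_iff_integrable_of_support_subset ?_).1 hi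
  intro x hx
  refine subset_tsupport _ ?_
  intro h0
  exact hx (by simp [h0])

/-- A continuous function `g` on `Ω` as a linear functional `φ ↦ ∫_Ω g φ`. -/
def funLin (k : Kind) (M : PosSeq) (Ω : TopologicalSpace.Opens (EuclideanSpace ℝ (Fin d)))
    (g : EuclideanSpace ℝ (Fin d) → ℂ) (hg : ContinuousOn g Ω) : TestSpace k M Ω →ₗ[ℂ] ℂ where
  toFun φ := ∫ x in (Ω : Set (EuclideanSpace ℝ (Fin d))), g x * φ.1 x
  map_add' φ ψ := by
    rw [← MeasureTheory.integral_add (integrableOn_mul_test hg φ) (integrableOn_mul_test hg ψ)]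
    congr 1
    funext x
    simp [mul_add]
  map_smul' c φ := by
    rw [RingHom.id_apply, ← MeasureTheory.integral_smul]
    congr 1
    funext x
    simp [mul_left_comm]

theorem isCont_funLin {g : EuclideanSpace ℝ (Fin d) → ℂ} (hg : ContinuousOn g Ω) :
    IsCont (funLin k M Ω g hg) := by
  intro K hK hKΩ
  have key : ∀ h : ℝ, ∃ C : ℝ, 0 ≤ C ∧ DualBound (funLin k M Ω g hg) K h C := by
    intro h
    refine ⟨(∫ x in K, ‖g x‖) * M.1 0, mul_nonneg (MeasureTheory.integral_nonneg
      fun x => norm_nonneg _) (M.2 0).le, ?_⟩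
    intro φ hφ B hB hn
    have hb : ∀ x ∈ K, ‖φ.1 x‖ ≤ B * M.1 0 := by
      intro x hx
      simpa [mpd_index_zero] using hn x hx 0
    have e : funLin k M Ω g hg φ = ∫ x in K, g x * φ.1 x := by
      change ∫ x in (Ω : Set (EuclideanSpace ℝ (Fin d))), g x * φ.1 x = _
      refine MeasureTheory.setIntegral_eq_of_subset_of_forall_sdiff_eq_zero
        Ω.isOpen.measurableSet hKΩ ?_
      intro x hx
      rw [image_eq_zero_of_notMem_tsupport fun h' => hx.2 (hφ h'), mul_zero]
    rw [e]
    calc ‖∫ x in K, g x * φ.1 x‖ ≤ ∫ x in K, ‖g x‖ * (B * M.1 0) := by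
          refine MeasureTheory.norm_integral_le_of_norm_le ?_ ?_
          · exact ((hg.mono hKΩ).norm.integrableOn_compact hK).mul_const _
          · refine (MeasureTheory.ae_restrict_iff' hK.measurableSet).2
              (Filter.Eventually.of_forall fun x hx => ?_)
            rw [norm_mul]
            exact mul_le_mul_of_nonneg_left (hb x hx) (norm_nonneg _)
      _ = (∫ x in K, ‖g x‖) * M.1 0 * B := by
          rw [MeasureTheory.integral_mul_const]
          ring
  cases k with
  | beurling => exact ⟨1, one_pos, key 1⟩
  | roumieu => exact fun h _ => key h

/-- A continuous function on `Ω` as an ultradistribution. -/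
def ofFun (k : Kind) (M : PosSeq) (Ω : TopologicalSpace.Opens (EuclideanSpace ℝ (Fin d)))
    (g : EuclideanSpace ℝ (Fin d) → ℂ) (hg : ContinuousOn g Ω) : UltraDistr k M Ω :=
  ⟨funLin k M Ω g hg, isCont_funLin hg⟩

end Functions

/-! ### Polynomials -/

/-- The polynomial function on `ℝ^d` defined by a polynomial with complex coefficients. -/
def polyFun (q : MvPolynomial (Fin d) ℂ) : EuclideanSpace ℝ (Fin d) → ℂ :=
  fun x => MvPolynomial.eval (fun i => ((x i : ℝ) : ℂ)) q

theorem continuous_polyFun (q : MvPolynomial (Fin d) ℂ) : Continuous (polyFun q) :=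
  (MvPolynomial.continuous_eval q).comp (by fun_prop)

/-- A polynomial as an ultradistribution. -/
def ofPoly (k : Kind) (M : PosSeq) (Ω : TopologicalSpace.Opens (EuclideanSpace ℝ (Fin d)))
    (q : MvPolynomial (Fin d) ℂ) : UltraDistr k M Ω :=
  ofFun k M Ω (polyFun q) (continuous_polyFun q).continuousOn

/-- `D^β q`, where `D = -i ∂`. -/
def polyD (β : Fin d →₀ ℕ) (q : MvPolynomial (Fin d) ℂ) : MvPolynomial (Fin d) ℂ :=
  ((-Complex.I) ^ β.degree) •
    (List.finRange d).foldr (fun i r => (MvPolynomial.pderiv i)^[β i] r) q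

/-- `β! = β_1! ⋯ β_d!`. -/
def multiFactorial (β : Fin d →₀ ℕ) : ℕ := ∏ i, (β i).factorial

/-! ### Ultradifferential operators -/

/-- The family `a` is the coefficient family of a `*`-ultradifferential operator
`P(D) = ∑_α a_α D^α`. -/
def IsUltraOp (k : Kind) (M : ℕ → ℝ) (a : (Fin d →₀ ℕ) → ℂ) : Prop :=
  match k with
  | .beurling => ∃ L : ℝ, 0 < L ∧ ∃ C : ℝ, 0 < C ∧
      ∀ α, ‖a α‖ ≤ C * L ^ α.degree / M α.degree
  | .roumieu => ∀ L : ℝ, 0 < L → ∃ C : ℝ, 0 < C ∧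
      ∀ α, ‖a α‖ ≤ C * L ^ α.degree / M α.degree

/-- The coefficients of the derivative `∂^β P(ξ) = ∑_α a_{α+β} ((α+β)! / α!) ξ^α` of the symbol
`P(ξ) = ∑_α a_α ξ^α`. -/
def symbolDeriv (β : Fin d →₀ ℕ) (a : (Fin d →₀ ℕ) → ℂ) : (Fin d →₀ ℕ) → ℂ :=
  fun α => ((∏ i, (α i + β i).descFactorial (β i) : ℕ) : ℂ) * a (α + β)

/-- `v = P(D) u` in `D^*'(Ω)`, where `P(D) = ∑_α a_α D^α`: for all test functions `φ` one has
`⟨v, φ⟩ = ⟨u, P(-D) φ⟩`, where `P(-D) φ = ∑_α a_α (-D)^α φ` and `(-D)^α = i^{|α|} ∂^α`. -/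
def IsUltraOpOf {k : Kind} {M : PosSeq}
    {Ω : TopologicalSpace.Opens (EuclideanSpace ℝ (Fin d))}
    (a : (Fin d →₀ ℕ) → ℂ) (u v : UltraDistr k M Ω) : Prop :=
  ∀ φ : TestSpace k M Ω, ∃ ψ : TestSpace k M Ω,
    (∀ x, HasSum (fun α => a α * Complex.I ^ α.degree * mpd α φ.1 x) (ψ.1 x)) ∧
      v.1 φ = u.1 ψ

/-! ### The properties of the algebra -/

/-- The properties `(P.1)`, `(P.2)`, `(P.3)` of an associative and commutative algebra `A`
containing `D^*'(Ω)` by means of `ι`, with operators `T a` on `A` playing the role of `P(D)` for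
the `*`-ultradifferential operator `P(D)` with coefficient family `a`. Here `*` is of kind `k` for
the sequence `M`, and `†` is of kind `k'` for the sequence `N`. -/
structure IsAdmissible (k : Kind) (M : PosSeq) (k' : Kind) (N : PosSeq)
    (Ω : TopologicalSpace.Opens (EuclideanSpace ℝ (Fin d)))
    (A : Type*) [CommRing A] [Algebra ℂ A]
    (ι : UltraDistr k M Ω →ₗ[ℂ] A) (T : ((Fin d →₀ ℕ) → ℂ) → (A →ₗ[ℂ] A)) : Prop where
  /-- `(P.1)`: the linear map `ι` is an embedding. -/
  injective : Function.Injective ι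
  /-- `(P.1)`: the constant function `1` is the unity. -/
  unity : ι (ofFun k M Ω (fun _ => 1) continuousOn_const) = 1
  /-- `(P.2)`: Leibniz' rule
  `P(D)(q ∘ f) = ∑_{|β| ≤ deg q} (1 / β!) D^β q ∘ (∂^β P)(D) f`. -/
  leibniz : ∀ a, IsUltraOp k M.1 a → ∀ (q : MvPolynomial (Fin d) ℂ) (f : A),
    T a (ι (ofPoly k M Ω q) * f) =
      ∑ n ∈ Finset.range (q.totalDegree + 1),
        ∑ β ∈ Finset.finsuppAntidiag (Finset.univ : Finset (Fin d)) n,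
          ((multiFactorial β : ℂ)⁻¹) •
            (ι (ofPoly k M Ω (polyD β q)) * T (symbolDeriv β a) f)
  /-- `(P.2)`: on `D^*'(Ω)` the operator is the usual one. -/
  usual : ∀ a, IsUltraOp k M.1 a → ∀ u v : UltraDistr k M Ω, IsUltraOpOf a u v →
    T a (ι u) = ι v
  /-- `(P.3)`: on `E^†(Ω)` the product is the pointwise product of functions. -/
  product : ∀ (f g : EuclideanSpace ℝ (Fin d) → ℂ)
    (hf : IsUltraDiff k' N.1 Ω f) (hg : IsUltraDiff k' N.1 Ω g),
    ι (ofFun k M Ω f hf.1.continuousOn) * ι (ofFun k M Ω g hg.1.continuousOn) =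
      ι (ofFun k M Ω (fun x => f x * g x) (hf.1.continuousOn.mul hg.1.continuousOn))

/-- There is an associative and commutative algebra `A^{*,†}(Ω)` over `ℂ` with the properties
`(P.1)`, `(P.2)`, `(P.3)`. -/
def ExistsAlgebra (k : Kind) (M : PosSeq) (k' : Kind) (N : PosSeq)
    (Ω : TopologicalSpace.Opens (EuclideanSpace ℝ (Fin d))) : Prop :=
  ∃ (A : Type u) (_ : CommRing A) (_ : Algebra ℂ A)
    (ι : UltraDistr k M Ω →ₗ[ℂ] A) (T : ((Fin d →₀ ℕ) → ℂ) → (A →ₗ[ℂ] A)),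
    IsAdmissible k M k' N Ω A ι T

end UltraImposs

end

noncomputable section

namespace UltraImposs

open MeasureTheory Filter

variable {d : ℕ}

/-! The argument is Schwartz's: fix a point y of Ω, a coordinate i, and put c = y_i. In the dual
there are two one-sided superpositions of waves, v₊ = ∫_{ξ>0} e^{i(x_i-c)ξ} dξ and v₋ = ∫_{ξ≤0}
e^{i(x_i-c)ξ} dξ, which are ± i / (x_i - c ± i0). Formally (x_i - c) v₊ = i and (x_i - c) v₋ = -i.
If both identities hold in an associative commutative algebra, computing v₊ ∘ (x_i - c) ∘ v₋ in two
ways gives i(v₊ + v₋) = 0. But v₊ + v₋ is 2π times the delta functional on the hyperplane x_i = c,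
which is not zero.

The identities must be derived from (P.1)-(P.3), where the product with x_i is prescribed only on
regular functions. So take P(ξ) = ∑ ξ^{2n} / Q_{2n} and write v = P(D) g, where g is the same
superposition weighted by 1/P. Since P ≥ |ξ|^m / Q_m on the real line for even m, the n-th
derivative of g is controlled by Q_{n+2} and Q_{n+3}, hence by h^n Q_n (`isUltraDiff_waveInt`).
Leibniz' rule with q = x_i gives x_i ∘ P(D)g = P(D)(x_i g) + i P'(D) g, where (P.3) makes x_i g an
ordinary product. The right-hand side is a concrete ultradistribution, computed on the Fourier side
in `integral_waveInt_commutator`; this yields `IsAdmissible.coord_mul`, and the contradiction is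
drawn in `not_existsAlgebra`.

The sequence Q must be large enough compared with M for P(D) to be an operator of class ∗, and small
enough compared with N for g to be of class †. When M ≺ N the geometric mean of M and N does both.
For ∗ = (M_p) and † = {M_p} both requirements are weak, and Q = M suffices.

Non-quasianalyticity enters through a test function on which v₊ + v₋ does not vanish: a product of
bumps obtained by infinitely many averages (`exists_bump`), with Fourier inversion in one variable.
-/

/-! ### Towers of partial derivatives -/

/-- The Euclidean space `ℝ^d`. -/
abbrev RSp (d : ℕ) : Type := EuclideanSpace ℝ (Fin d)

/-- A family of differentiable functions indexed by multi-indices such that `∂_i` shifts the index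
by `e_i`. -/
structure IsTower (T : (Fin d →₀ ℕ) → RSp d → ℂ) : Prop where
  differentiable : ∀ β, Differentiable ℝ (T β)
  pd_eq : ∀ β i, pd i (T β) = T (β + Finsupp.single i 1)

theorem clm_eq_sum (L : RSp d →L[ℝ] ℂ) :
    L = ∑ i, (EuclideanSpace.proj i : RSp d →L[ℝ] ℝ).smulRight (L (EuclideanSpace.single i 1)) := by
  ext x
  have hx : x = ∑ i, x i • (EuclideanSpace.single i (1 : ℝ) : RSp d) := by
    ext j
    simp [Pi.single_apply]
  conv_lhs => rw [hx]
  simp [map_sum]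

theorem fderiv_eq_sum_pd (f : RSp d → ℂ) (x : RSp d) :
    fderiv ℝ f x = ∑ i, (EuclideanSpace.proj i : RSp d →L[ℝ] ℝ).smulRight (pd i f x) :=
  clm_eq_sum _

/-- The induction runs over all members at once: the Fréchet derivative of a member is a linear
combination of members with constant coefficients, so mere differentiability of every member
bootstraps to smoothness. -/
theorem IsTower.contDiff_nat {T : (Fin d →₀ ℕ) → RSp d → ℂ} (hT : IsTower T) (n : ℕ) :
    ∀ β, ContDiff ℝ n (T β) := by
  induction n with
  | zero => exact fun β => contDiff_zero.2 (hT.differentiable β).continuous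
  | succ n ih =>
    intro β
    have hn : ((n + 1 : ℕ) : WithTop ℕ∞) = (n : WithTop ℕ∞) + 1 := by norm_cast
    rw [hn, contDiff_succ_iff_fderiv]
    refine ⟨hT.differentiable β, by simp, ?_⟩
    have e : fderiv ℝ (T β) = fun x => ∑ i, (EuclideanSpace.proj i : RSp d →L[ℝ] ℝ).smulRight
        (T (β + Finsupp.single i 1) x) := by
      funext x
      simp_rw [fderiv_eq_sum_pd, hT.pd_eq]
    rw [e]
    exact ContDiff.sum fun i _ => contDiff_const.smulRight (ih _)

theorem IsTower.contDiff {T : (Fin d →₀ ℕ) → RSp d → ℂ} (hT : IsTower T) (β : Fin d →₀ ℕ) :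
    ContDiff ℝ ∞ (T β) :=
  contDiff_infty.2 fun n => hT.contDiff_nat n β

theorem IsTower.pd_iterate {T : (Fin d →₀ ℕ) → RSp d → ℂ} (hT : IsTower T) (β : Fin d →₀ ℕ)
    (i : Fin d) (n : ℕ) : (pd i)^[n] (T β) = T (β + Finsupp.single i n) := by
  induction n with
  | zero => simp
  | succ n ih => rw [Function.iterate_succ_apply', ih, hT.pd_eq, add_assoc, ← Finsupp.single_add]

theorem IsTower.mpd_eq {T : (Fin d →₀ ℕ) → RSp d → ℂ} (hT : IsTower T) (α β : Fin d →₀ ℕ) :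
    mpd α (T β) = T (β + α) := by
  have key : ∀ l : List (Fin d), pdList α l (T β) =
      T (β + (l.map fun i => Finsupp.single i (α i)).sum) := by
    intro l
    induction l with
    | nil => simp [pdList]
    | cons i l ih =>
      change (pd i)^[α i] (pdList α l (T β)) = _
      rw [ih, hT.pd_iterate, List.map_cons, List.sum_cons, add_assoc, add_comm (List.sum _)]
  unfold mpd
  rw [key, ← List.ofFn_eq_map, List.sum_ofFn, Finsupp.univ_sum_single]

/-! ### The derivatives of a smooth function form a tower. -/

theorem contDiff_pd {f : RSp d → ℂ} (i : Fin d) (hf : ContDiff ℝ ∞ f) : ContDiff ℝ ∞ (pd i f) :=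
  (hf.fderiv_right (m := ∞) (by simp)).clm_apply contDiff_const

theorem contDiff_pd_iterate {f : RSp d → ℂ} (i : Fin d) (n : ℕ) (hf : ContDiff ℝ ∞ f) :
    ContDiff ℝ ∞ ((pd i)^[n] f) := by
  induction n with
  | zero => exact hf
  | succ n ih =>
    rw [Function.iterate_succ_apply']
    exact contDiff_pd i ih

theorem contDiff_pdList {f : RSp d → ℂ} (α : Fin d →₀ ℕ) (l : List (Fin d))
    (hf : ContDiff ℝ ∞ f) : ContDiff ℝ ∞ (pdList α l f) := by
  induction l with
  | nil => exact hf
  | cons i l ih => exact contDiff_pd_iterate i (α i) ih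

theorem pd_comm {f : RSp d → ℂ} (i j : Fin d) (hf : ContDiff ℝ ∞ f) :
    pd i (pd j f) = pd j (pd i f) := by
  have key : ∀ a b : Fin d, ∀ x, pd a (pd b f) x = fderiv ℝ (fderiv ℝ f) x
      (EuclideanSpace.single a 1) (EuclideanSpace.single b 1) := by
    intro a b x
    have hd : DifferentiableAt ℝ (fderiv ℝ f) x :=
      ((hf.fderiv_right (m := ∞) (by simp)).differentiable (by simp)) x
    change fderiv ℝ (fun y => fderiv ℝ f y (EuclideanSpace.single b 1)) x _ = _
    rw [fderiv_clm_apply hd (differentiableAt_const _)]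
    simp
  funext x
  rw [key, key]
  exact ((contDiff_infty.1 hf 2).contDiffAt.isSymmSndFDerivAt (by simp)).eq _ _

theorem pd_iterate_comm {f : RSp d → ℂ} (i j : Fin d) (n : ℕ) (hf : ContDiff ℝ ∞ f) :
    (pd j)^[n] (pd i f) = pd i ((pd j)^[n] f) := by
  induction n with
  | zero => rfl
  | succ n ih =>
    rw [Function.iterate_succ_apply', Function.iterate_succ_apply', ih,
      pd_comm j i (contDiff_pd_iterate j n hf)]

theorem pdList_congr_index {α β : Fin d →₀ ℕ} {l : List (Fin d)} (f : RSp d → ℂ)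
    (h : ∀ i ∈ l, α i = β i) : pdList α l f = pdList β l f := by
  induction l with
  | nil => rfl
  | cons i l ih =>
    change (pd i)^[α i] (pdList α l f) = (pd i)^[β i] (pdList β l f)
    rw [ih fun j hj => h j (List.mem_cons_of_mem _ hj), h i List.mem_cons_self]

/-- Symmetry of second derivatives moves ∂_i inward until it meets its own block; as the list has no
repetition, exactly one exponent is raised. -/
theorem pd_pdList {f : RSp d → ℂ} (hf : ContDiff ℝ ∞ f) (β : Fin d →₀ ℕ) (i : Fin d)
    {l : List (Fin d)} (hl : l.Nodup) (hi : i ∈ l) :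
    pd i (pdList β l f) = pdList (β + Finsupp.single i 1) l f := by
  induction l with
  | nil => simp at hi
  | cons j l ih =>
    rw [List.nodup_cons] at hl
    change pd i ((pd j)^[β j] (pdList β l f)) =
      (pd j)^[(β + Finsupp.single i 1 : Fin d →₀ ℕ) j] (pdList (β + Finsupp.single i 1) l f)
    by_cases hij : i = j
    · subst hij
      rw [pdList_congr_index (α := β + Finsupp.single i 1) (β := β) f]
      · simp [Function.iterate_succ_apply']
      · intro m hm
        have : i ≠ m := fun h => hl.1 (h ▸ hm)
        simp [this]
    · have hil : i ∈ l := (List.mem_cons.1 hi).resolve_left hij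
      rw [← ih hl.2 hil, pd_iterate_comm i j _ (contDiff_pdList β l hf)]
      simp [hij]

theorem isTower_mpd {f : RSp d → ℂ} (hf : ContDiff ℝ ∞ f) : IsTower fun β => mpd β f where
  differentiable β := (contDiff_pdList β _ hf).differentiable (by simp)
  pd_eq β i := pd_pdList hf β i (List.nodup_finRange d) (List.mem_finRange i)

theorem mpd_single {f : RSp d → ℂ} (hf : ContDiff ℝ ∞ f) (i : Fin d) (n : ℕ) :
    mpd (Finsupp.single i n) f = (pd i)^[n] f := by
  have := (isTower_mpd hf).pd_iterate 0 i n
  rw [zero_add, mpd_index_zero] at this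
  exact this.symm

/-- Termwise differentiation of a series of towers. -/
theorem isTower_tsum {T : ℕ → (Fin d →₀ ℕ) → RSp d → ℂ} (hT : ∀ n, IsTower (T n))
    {w : ℕ → (Fin d →₀ ℕ) → ℝ} (hw : ∀ β, Summable fun n => w n β)
    (hb : ∀ n β x, ‖T n β x‖ ≤ w n β) : IsTower fun β x => ∑' n, T n β x := by
  have key : ∀ β x, HasFDerivAt (fun x => ∑' n, T n β x) (∑' n, fderiv ℝ (T n β) x) x := by
    intro β x
    refine hasFDerivAt_tsum (u := fun n => ∑ i : Fin d,
      ‖(EuclideanSpace.proj i : RSp d →L[ℝ] ℝ)‖ * w n (β + Finsupp.single i 1)) ?_ ?_ ?_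
      (x₀ := 0) ?_ x
    · exact summable_sum fun i _ => (hw _).mul_left _
    · exact fun n y => ((hT n).differentiable β y).hasFDerivAt
    · intro n y
      rw [fderiv_eq_sum_pd]
      refine (norm_sum_le _ _).trans (Finset.sum_le_sum fun i _ => ?_)
      rw [ContinuousLinearMap.norm_smulRight_apply, (hT n).pd_eq]
      exact mul_le_mul_of_nonneg_left (hb _ _ _) (norm_nonneg _)
    · exact (hw β).of_norm_bounded fun n => hb n β 0
  refine ⟨fun β x => (key β x).differentiableAt, fun β i => ?_⟩
  funext x
  change fderiv ℝ (fun x => ∑' n, T n β x) x _ = _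
  rw [(key β x).fderiv]
  have hs : Summable fun n => fderiv ℝ (T n β) x := by
    refine Summable.of_norm_bounded (g := fun n => ∑ i : Fin d,
      ‖(EuclideanSpace.proj i : RSp d →L[ℝ] ℝ)‖ * w n (β + Finsupp.single i 1))
      (summable_sum fun i _ => (hw _).mul_left _) fun n => ?_
    rw [fderiv_eq_sum_pd]
    refine (norm_sum_le _ _).trans (Finset.sum_le_sum fun i _ => ?_)
    rw [ContinuousLinearMap.norm_smulRight_apply, (hT n).pd_eq]
    exact mul_le_mul_of_nonneg_left (hb _ _ _) (norm_nonneg _)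
  have := (ContinuousLinearMap.apply ℝ ℂ (EuclideanSpace.single i (1 : ℝ) : RSp d)).map_tsum hs
  refine this.trans (tsum_congr fun n => ?_)
  exact congrFun ((hT n).pd_eq β i) x

/-- The tower of a function of the single variable `x_i`. -/
theorem isTower_single (i : Fin d) {g : ℕ → RSp d → ℂ}
    (hg : ∀ n x, HasFDerivAt (g n)
      ((EuclideanSpace.proj i : RSp d →L[ℝ] ℝ).smulRight (g (n + 1) x)) x) :
    IsTower fun β => if ∀ j, j ≠ i → β j = 0 then g (β i) else 0 where
  differentiable β := by
    split_ifs
    · exact fun x => (hg _ x).differentiableAt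
    · exact differentiable_const _
  pd_eq β j := by
    by_cases h : ∀ j, j ≠ i → β j = 0
    · rw [if_pos h]
      have e : pd j (g (β i)) = fun x => if j = i then g (β i + 1) x else 0 := by
        funext x
        change fderiv ℝ (g (β i)) x _ = _
        rw [(hg _ x).fderiv]
        by_cases hji : j = i
        · simp [hji]
        · simp [hji, Ne.symm hji]
      rw [e]
      by_cases hji : j = i
      · subst hji
        rw [if_pos]
        · simp
        · intro m hm
          simp [h m hm, hm.symm]
      · rw [if_neg]
        · funext x
          simp [hji]
        · intro h'
          simpa using h' j hji
    · have h2 : ¬ ∀ m, m ≠ i → (β + Finsupp.single j 1 : Fin d →₀ ℕ) m = 0 := fun h' => h fun m hm => by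
        have := h' m hm
        simp only [Finsupp.add_apply] at this
        omega
      rw [if_neg h, if_neg h2]
      funext x
      simp [pd]

/-! ### Test functions are globally smooth -/

theorem tsupport_pd_subset (i : Fin d) (f : RSp d → ℂ) : tsupport (pd i f) ⊆ tsupport f := by
  refine closure_minimal (fun x hx => ?_) (isClosed_tsupport f)
  refine support_fderiv_subset ℝ (f := f) fun h => hx ?_
  simp only [pd, h]
  rfl

theorem tsupport_mpd_subset (α : Fin d →₀ ℕ) (f : RSp d → ℂ) :
    tsupport (mpd α f) ⊆ tsupport f := by
  unfold mpd
  induction List.finRange d with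
  | nil => exact subset_rfl
  | cons i l ih =>
    refine subset_trans ?_ ih
    change tsupport ((pd i)^[α i] (pdList α l f)) ⊆ _
    induction α i with
    | zero => exact subset_rfl
    | succ n ihn =>
      rw [Function.iterate_succ_apply']
      exact (tsupport_pd_subset i _).trans ihn

theorem mpd_eq_zero {α : Fin d →₀ ℕ} {f : RSp d → ℂ} {x : RSp d} (hx : x ∉ tsupport f) :
    mpd α f x = 0 :=
  image_eq_zero_of_notMem_tsupport fun h => hx (tsupport_mpd_subset α f h)

theorem mpd_add {f g : RSp d → ℂ} (α : Fin d →₀ ℕ) (hf : ContDiff ℝ ∞ f) (hg : ContDiff ℝ ∞ g)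
    (x : RSp d) : mpd α (f + g) x = mpd α f x + mpd α g x :=
  pdList_add (Ω := ⊤) α _ hf.contDiffOn hg.contDiffOn (Set.mem_univ x)

theorem mpd_smul {f : RSp d → ℂ} (α : Fin d →₀ ℕ) (c : ℂ) (hf : ContDiff ℝ ∞ f)
    (x : RSp d) : mpd α (c • f) x = c * mpd α f x :=
  pdList_smul (Ω := ⊤) α _ c hf.contDiffOn (Set.mem_univ x)

/-- All derivatives vanish off the support, so later estimates can be made on the whole space
without carrying `K` along. -/
theorem NormLE.global {M : ℕ → ℝ} (hM : ∀ p, 0 < M p) {h : ℝ} (h0 : 0 < h) {K : Set (RSp d)}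
    {f : RSp d → ℂ} {B : ℝ} (hB : 0 ≤ B) (hK : tsupport f ⊆ K) (hn : NormLE M h K f B) :
    NormLE M h Set.univ f B := by
  intro x _ α
  by_cases hx : x ∈ K
  · exact hn x hx α
  · rw [mpd_eq_zero fun h => hx (hK h), norm_zero]
    have := hM α.degree
    positivity

/-! ### One-variable ultradifferential operators on test functions and ultradistributions. -/

section Operators

variable {k : Kind} {M : PosSeq} {Ω : TopologicalSpace.Opens (RSp d)}

theorem contDiff_testSpace (φ : TestSpace k M Ω) : ContDiff ℝ ∞ φ.1 := by
  refine contDiff_iff_contDiffAt.2 fun x => ?_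
  by_cases hx : x ∈ tsupport φ.1
  · exact φ.2.1.1.contDiffAt (Ω.isOpen.mem_nhds (φ.2.2.2 hx))
  · exact contDiffAt_const.congr_of_eventuallyEq (notMem_tsupport_iff_eventuallyEq.1 hx)

/-- The function `∑_n b_n i^n ∂_i^n f`. -/
def opSum (i : Fin d) (b : ℕ → ℂ) (f : RSp d → ℂ) : RSp d → ℂ :=
  fun x => ∑' n, b n * Complex.I ^ n * mpd (Finsupp.single i n) f x

/-- The growth condition on the coefficients of an ultradifferential operator in one variable. -/
def IsUltraSeq (k : Kind) (M : ℕ → ℝ) (b : ℕ → ℂ) : Prop :=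
  match k with
  | .beurling => ∃ L : ℝ, 0 < L ∧ ∃ C : ℝ, 0 < C ∧ ∀ n, ‖b n‖ ≤ C * L ^ n / M n
  | .roumieu => ∀ L : ℝ, 0 < L → ∃ C : ℝ, 0 < C ∧ ∀ n, ‖b n‖ ≤ C * L ^ n / M n

/-- The coefficient family of the operator `∑_n b_n D_i^n`. -/
def liftCoeff (i : Fin d) (b : ℕ → ℂ) : (Fin d →₀ ℕ) → ℂ :=
  fun α => if α = Finsupp.single i (α i) then b (α i) else 0

theorem liftCoeff_single (i : Fin d) (b : ℕ → ℂ) (n : ℕ) :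
    liftCoeff i b (Finsupp.single i n) = b n := by
  simp [liftCoeff]

theorem liftCoeff_bound {M : ℕ → ℝ} (hM : ∀ p, 0 < M p) (i : Fin d) {b : ℕ → ℂ} {C L : ℝ}
    (hC : 0 < C) (hL : 0 < L) (hb : ∀ n, ‖b n‖ ≤ C * L ^ n / M n) (α : Fin d →₀ ℕ) :
    ‖liftCoeff i b α‖ ≤ C * L ^ α.degree / M α.degree := by
  by_cases h : α = Finsupp.single i (α i)
  · rw [h, liftCoeff_single, Finsupp.degree_single]
    exact hb _
  · rw [liftCoeff, if_neg h, norm_zero]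
    have := hM α.degree
    positivity

theorem IsUltraSeq.isUltraOp (hM : ∀ p, 0 < M.1 p) (i : Fin d) {b : ℕ → ℂ}
    (hb : IsUltraSeq k M.1 b) : IsUltraOp k M.1 (liftCoeff i b) := by
  cases k with
  | beurling =>
    obtain ⟨L, hL, C, hC, h⟩ := hb
    exact ⟨L, hL, C, hC, liftCoeff_bound hM i hC hL h⟩
  | roumieu =>
    intro L hL
    obtain ⟨C, hC, h⟩ := hb L hL
    exact ⟨C, hC, liftCoeff_bound hM i hC hL h⟩

/-- (M.2) splits M_{|β|+n}, and its factor M_n cancels the denominator of the coefficient bound.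
What is left of the n-dependence is (L h H)^n, so convergence only requires the product of L and h
to be small. -/
theorem opSum_term_bound {M : ℕ → ℝ} (hM : ∀ p, 0 < M p) {A H C L h B : ℝ} (hA : 1 ≤ A)
    (hH : 1 ≤ H) (hM2 : ∀ p q, M (p + q) ≤ A * H ^ (p + q) * M p * M q) (hC : 0 < C) (hL : 0 < L)
    (hh : 0 < h) (hB : 0 ≤ B) (hLh : L * h * H ≤ 1 / 2) {b : ℕ → ℂ}
    (hb : ∀ n, ‖b n‖ ≤ C * L ^ n / M n) (i : Fin d) {f : RSp d → ℂ}
    (hn : NormLE M h Set.univ f B) (n : ℕ) (β : Fin d →₀ ℕ) (x : RSp d) :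
    ‖b n * Complex.I ^ n * mpd (β + Finsupp.single i n) f x‖ ≤
      C * A * B * ((h * H) ^ β.degree * M β.degree) * (1 / 2) ^ n := by
  have h1 := hn x (Set.mem_univ x) (β + Finsupp.single i n)
  have hdeg : (β + Finsupp.single i n).degree = β.degree + n := by
    simp
  rw [hdeg] at h1
  have hMn := hM n
  have hMb := hM β.degree
  rw [norm_mul, norm_mul, norm_pow, Complex.norm_I, one_pow, mul_one]
  calc ‖b n‖ * ‖mpd (β + Finsupp.single i n) f x‖
      ≤ (C * L ^ n / M n) * (B * (h ^ (β.degree + n) * (A * H ^ (β.degree + n) *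
          M β.degree * M n))) := by
        refine mul_le_mul (hb n) (h1.trans ?_) (norm_nonneg _) (by positivity)
        gcongr
        exact hM2 _ _
    _ = C * A * B * ((h * H) ^ β.degree * M β.degree) * (L * h * H) ^ n := by
        field_simp
        ring
    _ ≤ _ := by gcongr

/-- `P(-D) f` is smooth, and its derivatives are estimated by those of `f`. -/
theorem opSum_estimate {M : ℕ → ℝ} (hM : ∀ p, 0 < M p) {A H C L h B : ℝ} (hA : 1 ≤ A)
    (hH : 1 ≤ H) (hM2 : ∀ p q, M (p + q) ≤ A * H ^ (p + q) * M p * M q) (hC : 0 < C) (hL : 0 < L)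
    (hh : 0 < h) (hB : 0 ≤ B) (hLh : L * h * H ≤ 1 / 2) {b : ℕ → ℂ}
    (hb : ∀ n, ‖b n‖ ≤ C * L ^ n / M n) (i : Fin d) {f : RSp d → ℂ} (hf : ContDiff ℝ ∞ f)
    (hn : NormLE M h Set.univ f B) :
    ContDiff ℝ ∞ (opSum i b f) ∧ NormLE M (h * H) Set.univ (opSum i b f) (2 * C * A * B) := by
  have hT : IsTower fun β x => ∑' n, b n * Complex.I ^ n * mpd (β + Finsupp.single i n) f x := by
    refine isTower_tsum (T := fun n β x => b n * Complex.I ^ n * mpd (β + Finsupp.single i n) f x)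
      ?_ (w := fun n β => C * A * B * ((h * H) ^ β.degree * M β.degree) * (1 / 2) ^ n) ?_ ?_
    · intro n
      refine ⟨fun β => ((isTower_mpd hf).differentiable _).const_mul _, fun β j => ?_⟩
      funext x
      have hdx : DifferentiableAt ℝ (mpd (β + Finsupp.single i n) f) x :=
        (isTower_mpd hf).differentiable _ x
      change fderiv ℝ (fun x => b n * Complex.I ^ n * mpd (β + Finsupp.single i n) f x) x _ = _
      rw [fderiv_const_mul hdx]
      have := congrFun ((isTower_mpd hf).pd_eq (β + Finsupp.single i n) j) x
      rw [add_right_comm] at this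
      simp only [← this, pd]
      rfl
    · exact fun β => summable_geometric_two.mul_left _
    · exact opSum_term_bound hM hA hH hM2 hC hL hh hB hLh hb i hn
  have e : opSum i b f = (fun (β : Fin d →₀ ℕ) x =>
      ∑' n, b n * Complex.I ^ n * mpd (β + Finsupp.single i n) f x) 0 := by
    funext x
    simp [opSum]
  refine ⟨e ▸ hT.contDiff 0, fun x _ α => ?_⟩
  rw [e, hT.mpd_eq, zero_add]
  refine (tsum_of_norm_bounded (summable_geometric_two.mul_left _).hasSum
    fun n => opSum_term_bound hM hA hH hM2 hC hL hh hB hLh hb i hn n α x).trans ?_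
  rw [tsum_mul_left, tsum_geometric_two]
  apply le_of_eq
  ring

theorem opSum_eq_zero (i : Fin d) (b : ℕ → ℂ) {f : RSp d → ℂ} {x : RSp d} (hx : x ∉ tsupport f) :
    opSum i b f x = 0 := by
  simp [opSum, mpd_eq_zero hx]

theorem tsupport_opSum_subset (i : Fin d) (b : ℕ → ℂ) (f : RSp d → ℂ) :
    tsupport (opSum i b f) ⊆ tsupport f :=
  closure_minimal (fun x hx => by
    by_contra h
    exact hx (opSum_eq_zero i b h)) (isClosed_tsupport f)

/-- Constants for which `P(-D) φ` can be estimated. -/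
theorem exists_opBounds (φ : TestSpace k M Ω) {b : ℕ → ℂ} (hb : IsUltraSeq k M.1 b)
    {H : ℝ} (hH : 1 ≤ H) : ∃ C L h B : ℝ, 0 < C ∧ 0 < L ∧ 0 < h ∧ 0 ≤ B ∧ L * h * H ≤ 1 / 2 ∧
      (∀ n, ‖b n‖ ≤ C * L ^ n / M.1 n) ∧ NormLE M.1 h Set.univ φ.1 B := by
  have hφ := φ.2.1.2 _ φ.2.2.1 φ.2.2.2
  cases k with
  | beurling =>
    obtain ⟨L, hL, C, hC, h⟩ := hb
    -- Beurling case: the operator dictates L and the test function admits every h. In the Roumieu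
    -- case the roles are exchanged.
    obtain ⟨B, hB, hn⟩ := hφ (1 / (2 * L * H)) (by positivity)
    refine ⟨C, L, _, B, hC, hL, by positivity, hB, ?_, h, hn.global M.2 (by positivity) hB subset_rfl⟩
    apply le_of_eq
    field_simp
  | roumieu =>
    obtain ⟨h, hh, B, hB, hn⟩ := hφ
    obtain ⟨C, hC, hbC⟩ := hb (1 / (2 * h * H)) (by positivity)
    refine ⟨C, _, h, B, hC, by positivity, hh, hB, ?_, hbC, hn.global M.2 hh hB subset_rfl⟩
    apply le_of_eq
    field_simp

theorem exists_summable_bound (hM2 : CondM2 M.1) {b : ℕ → ℂ} (hb : IsUltraSeq k M.1 b)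
    (i : Fin d) (φ : TestSpace k M Ω) : ∃ w : ℕ → ℝ, Summable w ∧
      ∀ n x, ‖b n * Complex.I ^ n * mpd (Finsupp.single i n) φ.1 x‖ ≤ w n := by
  obtain ⟨A, H, hA, hH, h2⟩ := hM2
  obtain ⟨C, L, h, B, hC, hL, hh, hB, hLh, hbC, hn⟩ := exists_opBounds φ hb hH
  refine ⟨fun n => C * A * B * ((h * H) ^ 0 * M.1 0) * (1 / 2) ^ n,
    summable_geometric_two.mul_left _, fun n x => ?_⟩
  simpa using opSum_term_bound M.2 hA hH h2 hC hL hh hB hLh hbC i hn n 0 x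

theorem summable_opSum (hM2 : CondM2 M.1) {b : ℕ → ℂ} (hb : IsUltraSeq k M.1 b)
    (i : Fin d) (φ : TestSpace k M Ω) (x : RSp d) :
    Summable fun n => b n * Complex.I ^ n * mpd (Finsupp.single i n) φ.1 x := by
  obtain ⟨w, hw, h⟩ := exists_summable_bound hM2 hb i φ
  exact hw.of_norm_bounded fun n => h n x

theorem opSum_mem (hM2 : CondM2 M.1) {b : ℕ → ℂ} (hb : IsUltraSeq k M.1 b)
    (i : Fin d) (φ : TestSpace k M Ω) : opSum i b φ.1 ∈ TestSpace k M Ω := by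
  obtain ⟨A, H, hA, hH, h2⟩ := hM2
  have hH0 : 0 < H := by linarith
  refine ⟨⟨?_, fun K _ _ => ?_⟩, ?_, (tsupport_opSum_subset i b φ.1).trans φ.2.2.2⟩
  · obtain ⟨C, L, h, B, hC, hL, hh, hB, hLh, hbC, hn⟩ := exists_opBounds φ hb hH
    exact (opSum_estimate M.2 hA hH h2 hC hL hh hB hLh hbC i (contDiff_testSpace φ) hn).1.contDiffOn
  · cases k with
    | beurling =>
      intro h hh
      obtain ⟨L, hL, C, hC, hbC⟩ := hb
      -- The first entry makes the scale after the loss of the factor H at most h; the second makes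
      -- the series converge.
      have hh' : 0 < min (h / H) (1 / (2 * L * H)) := by positivity
      obtain ⟨B, hB, hn⟩ := φ.2.1.2 _ φ.2.2.1 φ.2.2.2 _ hh'
      refine ⟨2 * C * A * B, by positivity, ?_⟩
      have := (opSum_estimate M.2 hA hH h2 hC hL hh' hB ?_ hbC i (contDiff_testSpace φ)
        (hn.global M.2 hh' hB subset_rfl)).2
      · refine NormLE.mono M.2 (by positivity) ?_ (by positivity) fun x _ => this x (Set.mem_univ x)
        rw [← le_div_iff₀ hH0]
        exact min_le_left _ _
      · calc L * min (h / H) (1 / (2 * L * H)) * H ≤ L * (1 / (2 * L * H)) * H := by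
              gcongr
              exact min_le_right _ _
          _ = 1 / 2 := by field_simp
    | roumieu =>
      obtain ⟨C, L, h, B, hC, hL, hh, hB, hLh, hbC, hn⟩ := exists_opBounds φ hb hH
      exact ⟨h * H, by positivity, 2 * C * A * B, by positivity, fun x _ =>
        (opSum_estimate M.2 hA hH h2 hC hL hh hB hLh hbC i (contDiff_testSpace φ) hn).2 x (Set.mem_univ x)⟩
  · exact φ.2.2.1.of_isClosed_subset (isClosed_tsupport _) (tsupport_opSum_subset i b φ.1)

/-- The operator `P(-D)` on test functions, where `P(D) = ∑_n b_n D_i^n`. -/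
def opTest (hM2 : CondM2 M.1) {b : ℕ → ℂ} (hb : IsUltraSeq k M.1 b) (i : Fin d) :
    TestSpace k M Ω →ₗ[ℂ] TestSpace k M Ω where
  toFun φ := ⟨opSum i b φ.1, opSum_mem hM2 hb i φ⟩
  map_add' φ ψ := by
    ext x
    change ∑' n, b n * Complex.I ^ n * mpd (Finsupp.single i n) (φ.1 + ψ.1) x =
      opSum i b φ.1 x + opSum i b ψ.1 x
    simp only [mpd_add _ (contDiff_testSpace φ) (contDiff_testSpace ψ), mul_add]
    exact (summable_opSum hM2 hb i φ x).tsum_add (summable_opSum hM2 hb i ψ x)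
  map_smul' c φ := by
    ext x
    change ∑' n, b n * Complex.I ^ n * mpd (Finsupp.single i n) (c • φ.1) x =
      c * opSum i b φ.1 x
    simp only [mpd_smul _ c (contDiff_testSpace φ), opSum]
    rw [← tsum_mul_left]
    exact tsum_congr fun n => by ring

/-- By transposition of `opSum_estimate`: `opTest` maps scale h to scale h * H, so a bound for `v`
at scale h * H becomes one for the composition at scale h, provided L * h * H ≤ 1/2. -/
theorem isCont_comp_opTest (hM2 : CondM2 M.1) {b : ℕ → ℂ} (hb : IsUltraSeq k M.1 b) (i : Fin d)
    {v : TestSpace k M Ω →ₗ[ℂ] ℂ} (hv : IsCont v) : IsCont (v ∘ₗ opTest hM2 hb i) := by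
  intro K hK hKΩ
  obtain ⟨A, H, hA, hH, h2⟩ := id hM2
  have hH0 : 0 < H := by linarith
  have hvK := hv K hK hKΩ
  have key : ∀ C L h C' : ℝ, 0 < C → 0 < L → 0 < h → (∀ n, ‖b n‖ ≤ C * L ^ n / M.1 n) →
      L * h * H ≤ 1 / 2 → DualBound v K (h * H) C' →
      DualBound (v ∘ₗ opTest hM2 hb i) K h (C' * (2 * C * A)) := by
    intro C L h C' hC hL hh hbC hLh hD φ hφ B hB hn
    have := hD (opTest hM2 hb i φ) ((tsupport_opSum_subset i b φ.1).trans hφ) (2 * C * A * B)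
      (by positivity) fun x _ => (opSum_estimate M.2 hA hH h2 hC hL hh hB hLh hbC i (contDiff_testSpace φ)
        (hn.global M.2 hh hB hφ)).2 x (Set.mem_univ x)
    rw [mul_assoc C']
    exact this
  cases k with
  | beurling =>
    obtain ⟨L, hL, C, hC, hbC⟩ := hb
    obtain ⟨h, hh, C', hC', hD⟩ := hvK
    have hh' : 0 < min (h / H) (1 / (2 * L * H)) := by positivity
    refine ⟨_, hh', C' * (2 * C * A), by positivity, key C L _ C' hC hL hh' hbC ?_ ?_⟩
    · calc L * min (h / H) (1 / (2 * L * H)) * H ≤ L * (1 / (2 * L * H)) * H := by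
            gcongr
            exact min_le_right _ _
        _ = 1 / 2 := by field_simp
    · refine hD.anti (by positivity) ?_
      rw [← le_div_iff₀ hH0]
      exact min_le_left _ _
  | roumieu =>
    intro h hh
    obtain ⟨C, hC, hbC⟩ := hb (1 / (2 * h * H)) (by positivity)
    obtain ⟨C', hC', hD⟩ := hvK (h * H) (by positivity)
    refine ⟨C' * (2 * C * A), by positivity, key C _ h C' hC (by positivity) hh hbC ?_ hD⟩
    apply le_of_eq
    field_simp

/-- The ultradistribution `P(D) v`, where `P(D) = ∑_n b_n D_i^n`. -/
def opDistr (hM2 : CondM2 M.1) {b : ℕ → ℂ} (hb : IsUltraSeq k M.1 b) (i : Fin d)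
    (v : UltraDistr k M Ω) : UltraDistr k M Ω :=
  ⟨v.1 ∘ₗ opTest hM2 hb i, isCont_comp_opTest hM2 hb i v.2⟩

/-- The coefficients vanish off the multiples of e_i, so the sum over multi-indices collapses to the
series in `opSum`, whose factors I^n already account for -D = i∂. -/
theorem isUltraOpOf_opDistr (hM2 : CondM2 M.1) {b : ℕ → ℂ} (hb : IsUltraSeq k M.1 b) (i : Fin d)
    (v : UltraDistr k M Ω) : IsUltraOpOf (liftCoeff i b) v (opDistr hM2 hb i v) := by
  intro φ
  refine ⟨opTest hM2 hb i φ, fun x => ?_, rfl⟩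
  rw [← (Finsupp.single_injective (M := ℕ) i).hasSum_iff]
  · simp only [Function.comp_def, liftCoeff_single, Finsupp.degree_single]
    exact (summable_opSum hM2 hb i φ x).hasSum
  · intro α hα
    rw [liftCoeff, if_neg fun h => hα ⟨_, h.symm⟩, zero_mul, zero_mul]

end Operators

/-! ### Oscillatory integrals -/

theorem measurable_osc {α : Type*} [MeasurableSpace α] {s : α → ℝ} (hs : Measurable s) (t : ℝ) :
    Measurable fun a => Complex.exp ((s a * t : ℝ) * Complex.I) := by
  fun_prop

theorem integrable_osc {α : Type*} [MeasurableSpace α] {μ : Measure α} {s : α → ℝ}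
    (hs : Measurable s) {F : α → ℂ} (hF : Integrable F μ) (t : ℝ) :
    Integrable (fun a => Complex.exp ((s a * t : ℝ) * Complex.I) * F a) μ :=
  hF.bdd_mul (measurable_osc hs t).aestronglyMeasurable
    (Filter.Eventually.of_forall fun _ => (Complex.norm_exp_ofReal_mul_I _).le)

/-- Differentiation of an oscillatory integral with respect to the frequency. -/
theorem hasDerivAt_osc {α : Type*} [MeasurableSpace α] {μ : Measure α} {s : α → ℝ}
    (hs : Measurable s) {F : α → ℂ} (hF : Integrable F μ)
    (hsF : Integrable (fun a => (s a : ℂ) * F a) μ) (t : ℝ) :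
    HasDerivAt (fun t : ℝ => ∫ a, Complex.exp ((s a * t : ℝ) * Complex.I) * F a ∂μ)
      (∫ a, Complex.exp ((s a * t : ℝ) * Complex.I) * (Complex.I * (s a * F a)) ∂μ) t := by
  refine (hasDerivAt_integral_of_dominated_loc_of_deriv_le (bound := fun a => ‖(s a : ℂ) * F a‖)
    (s := Set.univ)
    (F := fun t a => Complex.exp ((s a * t : ℝ) * Complex.I) * F a)
    (F' := fun t a => Complex.exp ((s a * t : ℝ) * Complex.I) * (Complex.I * (s a * F a)))
    Filter.univ_mem ?_ (integrable_osc hs hF t) ?_ ?_ hsF.norm ?_).2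
  · exact Filter.Eventually.of_forall fun t => (integrable_osc hs hF t).aestronglyMeasurable
  · exact (integrable_osc hs (hsF.const_mul Complex.I) t).aestronglyMeasurable
  · refine Filter.Eventually.of_forall fun a t _ => ?_
    rw [norm_mul, Complex.norm_exp_ofReal_mul_I, one_mul, norm_mul Complex.I, Complex.norm_I,
      one_mul]
  · refine Filter.Eventually.of_forall fun a t _ => ?_
    have h1 : HasDerivAt (fun t : ℝ => ((s a * t : ℝ) : ℂ) * Complex.I)
        ((s a : ℂ) * Complex.I) t := by
      have : HasDerivAt (fun t : ℝ => s a * t) (s a) t := by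
        simpa using (hasDerivAt_id t).const_mul (s a)
      exact (this.ofReal_comp).mul_const _
    refine ((h1.cexp).mul_const (F a)).congr_deriv ?_
    ring

/-! ### The Fourier transform in one of the variables -/

/-- The function `x ↦ e^{i (x_i - c) ξ}`. -/
def wave (i : Fin d) (c ξ : ℝ) : RSp d → ℂ :=
  fun x => Complex.exp (((x i - c) * ξ : ℝ) * Complex.I)

/-- The integral `∫ e^{i (x_i - c) ξ} f(x) dx`. -/
def ft (i : Fin d) (c : ℝ) (f : RSp d → ℂ) (ξ : ℝ) : ℂ := ∫ x, wave i c ξ x * f x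

/-- The function `(x_i - c) f(x)`. -/
def shiftMul (i : Fin d) (c : ℝ) (f : RSp d → ℂ) : RSp d → ℂ :=
  fun x => ((x i - c : ℝ) : ℂ) * f x

theorem measurable_coord (i : Fin d) (c : ℝ) : Measurable fun x : RSp d => x i - c := by
  fun_prop

theorem norm_wave (i : Fin d) (c ξ : ℝ) (x : RSp d) : ‖wave i c ξ x‖ = 1 :=
  Complex.norm_exp_ofReal_mul_I _

theorem hasFDerivAt_coord (i : Fin d) (c : ℝ) (x : RSp d) :
    HasFDerivAt (fun x : RSp d => x i - c) (EuclideanSpace.proj i : RSp d →L[ℝ] ℝ) x :=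
  (EuclideanSpace.proj i : RSp d →L[ℝ] ℝ).hasFDerivAt.sub_const c

theorem hasFDerivAt_wave (i : Fin d) (c ξ : ℝ) (x : RSp d) :
    HasFDerivAt (wave i c ξ) ((EuclideanSpace.proj i : RSp d →L[ℝ] ℝ).smulRight
      (Complex.I * ξ * wave i c ξ x)) x := by
  have h1 : ∀ t : ℝ, HasDerivAt (fun t : ℝ => Complex.exp ((t * ξ : ℝ) * Complex.I))
      (Complex.I * ξ * Complex.exp ((t * ξ : ℝ) * Complex.I)) t := by
    intro t
    have : HasDerivAt (fun t : ℝ => t * ξ) ξ t := by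
      simpa using (hasDerivAt_id t).mul_const ξ
    convert ((this.ofReal_comp).mul_const Complex.I).cexp using 1
    ring
  have := (h1 (x i - c)).hasFDerivAt.comp x (hasFDerivAt_coord i c x)
  refine this.congr_fderiv ?_
  ext v
  simp [wave]

theorem pd_wave (i : Fin d) (c ξ : ℝ) (x : RSp d) :
    pd i (wave i c ξ) x = Complex.I * ξ * wave i c ξ x := by
  rw [pd, (hasFDerivAt_wave i c ξ x).fderiv]
  simp

theorem contDiff_shiftMul (i : Fin d) (c : ℝ) {f : RSp d → ℂ} (hf : ContDiff ℝ ∞ f) :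
    ContDiff ℝ ∞ (shiftMul i c f) := by
  have h : ContDiff ℝ ∞ fun x : RSp d => x i - c :=
    (EuclideanSpace.proj i : RSp d →L[ℝ] ℝ).contDiff.sub contDiff_const
  exact (Complex.ofRealCLM.contDiff.comp h).mul hf

theorem hasCompactSupport_shiftMul (i : Fin d) (c : ℝ) {f : RSp d → ℂ}
    (hf : HasCompactSupport f) : HasCompactSupport (shiftMul i c f) :=
  hf.mul_left

theorem hasCompactSupport_pd (i : Fin d) {f : RSp d → ℂ} (hf : HasCompactSupport f) :
    HasCompactSupport (pd i f) :=
  hf.of_isClosed_subset (isClosed_tsupport _) (tsupport_pd_subset i f)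

theorem hasCompactSupport_pd_iterate (i : Fin d) (n : ℕ) {f : RSp d → ℂ}
    (hf : HasCompactSupport f) : HasCompactSupport ((pd i)^[n] f) := by
  induction n with
  | zero => exact hf
  | succ n ih =>
    rw [Function.iterate_succ_apply']
    exact hasCompactSupport_pd i ih

theorem pd_shiftMul (i : Fin d) (c : ℝ) {f : RSp d → ℂ} (hf : ContDiff ℝ ∞ f) :
    pd i (shiftMul i c f) = fun x => shiftMul i c (pd i f) x + f x := by
  funext x
  have h1 : HasFDerivAt (fun x : RSp d => ((x i - c : ℝ) : ℂ))
      (Complex.ofRealCLM.comp (EuclideanSpace.proj i : RSp d →L[ℝ] ℝ)) x :=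
    Complex.ofRealCLM.hasFDerivAt.comp x (hasFDerivAt_coord i c x)
  have h2 := (hf.differentiable (by simp) x).hasFDerivAt
  change fderiv ℝ (fun x => ((x i - c : ℝ) : ℂ) * f x) x _ = _
  have h3 : HasFDerivAt (fun x : RSp d => ((x i - c : ℝ) : ℂ) * f x) _ x := h1.mul h2
  rw [h3.fderiv]
  simp [shiftMul, pd]

theorem pd_iterate_shiftMul (i : Fin d) (c : ℝ) (n : ℕ) {f : RSp d → ℂ} (hf : ContDiff ℝ ∞ f)
    (x : RSp d) : (pd i)^[n] (shiftMul i c f) x =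
      shiftMul i c ((pd i)^[n] f) x + n * (pd i)^[n - 1] f x := by
  induction n generalizing f with
  | zero => simp
  | succ n ih =>
    rw [Function.iterate_succ_apply, pd_shiftMul i c hf]
    have := pdIter_add (Ω := ⊤) i n (contDiff_shiftMul i c (contDiff_pd i hf)).contDiffOn
      hf.contDiffOn
    refine (this.2 (Set.mem_univ x)).trans ?_
    rw [Pi.add_apply, ih (contDiff_pd i hf), Function.iterate_succ_apply]
    rcases n with _ | n
    · simp
    · simp only [Nat.add_sub_cancel, ← Function.iterate_succ_apply]
      push_cast
      ring

theorem integrable_wave_mul (i : Fin d) (c ξ : ℝ) {f : RSp d → ℂ} (hf : Integrable f) :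
    Integrable fun x => wave i c ξ x * f x :=
  integrable_osc (measurable_coord i c) hf ξ

theorem ft_pd (i : Fin d) (c ξ : ℝ) {f : RSp d → ℂ} (hf : ContDiff ℝ ∞ f)
    (hc : HasCompactSupport f) : ft i c (pd i f) ξ = -(Complex.I * ξ) * ft i c f ξ := by
  have hi : Integrable f := hf.continuous.integrable_of_hasCompactSupport hc
  have hi' : Integrable (pd i f) :=
    (contDiff_pd i hf).continuous.integrable_of_hasCompactSupport (hasCompactSupport_pd i hc)
  have e : ∀ x, (fderiv ℝ (wave i c ξ) x) (EuclideanSpace.single i 1) * f x =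
      Complex.I * ξ * (wave i c ξ x * f x) := by
    intro x
    rw [← mul_assoc, ← pd_wave]
    rfl
  have := integral_mul_fderiv_eq_neg_fderiv_mul_of_integrable (μ := volume) (f := wave i c ξ)
    (g := f) (v := EuclideanSpace.single i (1 : ℝ)) ?_ (integrable_wave_mul i c ξ hi')
    (integrable_wave_mul i c ξ hi) (fun x _ => (hasFDerivAt_wave i c ξ x).differentiableAt)
    (fun x _ => hf.differentiable (by simp) x)
  · refine this.trans ?_
    simp_rw [e]
    rw [integral_const_mul, neg_mul]
    rfl
  · simp_rw [e]
    exact (integrable_wave_mul i c ξ hi).const_mul _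

theorem ft_pd_iterate (i : Fin d) (c ξ : ℝ) (n : ℕ) {f : RSp d → ℂ} (hf : ContDiff ℝ ∞ f)
    (hc : HasCompactSupport f) :
    Complex.I ^ n * ft i c ((pd i)^[n] f) ξ = (ξ : ℂ) ^ n * ft i c f ξ := by
  induction n with
  | zero => simp
  | succ n ih =>
    rw [Function.iterate_succ_apply', ft_pd i c ξ (contDiff_pd_iterate i n hf)
      (hasCompactSupport_pd_iterate i n hc)]
    calc _ = -(Complex.I * Complex.I) * ξ * (Complex.I ^ n * ft i c ((pd i)^[n] f) ξ) := by ring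
      _ = _ := by
        rw [ih, Complex.I_mul_I]
        ring

theorem norm_ft_le (i : Fin d) (c ξ : ℝ) (f : RSp d → ℂ) : ‖ft i c f ξ‖ ≤ ∫ x, ‖f x‖ := by
  refine (norm_integral_le_integral_norm _).trans (le_of_eq ?_)
  simp [norm_wave]

/-- Two derivatives are enough: (1 + ξ²) times the transform is bounded by the L¹ norms of f and
∂_i² f. -/
theorem ft_decay (i : Fin d) (c : ℝ) {f : RSp d → ℂ} (hf : ContDiff ℝ ∞ f)
    (hc : HasCompactSupport f) : ∃ C : ℝ, ∀ ξ : ℝ, ‖ft i c f ξ‖ ≤ C * (1 + ξ ^ 2)⁻¹ := by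
  refine ⟨(∫ x, ‖f x‖) + ∫ x, ‖(pd i)^[2] f x‖, fun ξ => ?_⟩
  have hpos : 0 < 1 + ξ ^ 2 := by positivity
  rw [← div_eq_mul_inv, le_div_iff₀ hpos]
  have h2 := ft_pd_iterate i c ξ 2 hf hc
  have e : ft i c f ξ * ((1 + ξ ^ 2 : ℝ) : ℂ) = ft i c f ξ + Complex.I ^ 2 *
      ft i c ((pd i)^[2] f) ξ := by
    rw [h2]
    push_cast
    ring
  have e2 : ‖ft i c f ξ‖ * (1 + ξ ^ 2) = ‖ft i c f ξ * ((1 + ξ ^ 2 : ℝ) : ℂ)‖ := by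
    rw [norm_mul, Complex.norm_real, Real.norm_of_nonneg hpos.le]
  rw [e2, e]
  refine (norm_add_le _ _).trans (add_le_add (norm_ft_le _ _ _ _) ?_)
  rw [norm_mul, norm_pow, Complex.norm_I, one_pow, one_mul]
  exact norm_ft_le _ _ _ _

theorem hasDerivAt_ft (i : Fin d) (c : ℝ) {f : RSp d → ℂ} (hf : ContDiff ℝ ∞ f)
    (hc : HasCompactSupport f) (ξ : ℝ) :
    HasDerivAt (ft i c f) (Complex.I * ft i c (shiftMul i c f) ξ) ξ := by
  have := hasDerivAt_osc (μ := volume) (measurable_coord i c)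
    (hf.continuous.integrable_of_hasCompactSupport hc)
    ((contDiff_shiftMul i c hf).continuous.integrable_of_hasCompactSupport
      (hasCompactSupport_shiftMul i c hc)) ξ
  refine this.congr_deriv ?_
  unfold ft
  rw [← integral_const_mul]
  congr 1
  funext x
  simp only [wave, shiftMul]
  ring

theorem integrable_ft (i : Fin d) (c : ℝ) {f : RSp d → ℂ} (hf : ContDiff ℝ ∞ f)
    (hc : HasCompactSupport f) : Integrable (ft i c f) := by
  obtain ⟨C, hC⟩ := ft_decay i c hf hc
  have hcont : Continuous (ft i c f) :=
    continuous_iff_continuousAt.2 fun ξ => (hasDerivAt_ft i c hf hc ξ).continuousAt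
  exact (integrable_inv_one_add_sq.const_mul C).mono' hcont.aestronglyMeasurable
    (Filter.Eventually.of_forall hC)

theorem tendsto_ft (i : Fin d) (c : ℝ) {f : RSp d → ℂ} (hf : ContDiff ℝ ∞ f)
    (hc : HasCompactSupport f) {l : Filter ℝ} (hl : Filter.Tendsto (fun ξ : ℝ => |ξ|) l Filter.atTop) :
    Filter.Tendsto (ft i c f) l (nhds 0) := by
  obtain ⟨C, hC⟩ := ft_decay i c hf hc
  refine squeeze_zero_norm hC ?_
  rw [← mul_zero C]
  refine Filter.Tendsto.const_mul C (Filter.Tendsto.inv_tendsto_atTop ?_)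
  refine Filter.tendsto_atTop_add_const_left _ _ ?_
  have := (Filter.tendsto_pow_atTop (α := ℝ) two_ne_zero).comp hl
  simpa [Function.comp_def] using this

/-- Multiplication by x_i - c is, up to the factor i, differentiation in the frequency, so the
integral over a half-line reduces to the boundary value at 0. This is the tested form of (x_i - c)
v₊ = i. -/
theorem integral_Ioi_ft_shiftMul (i : Fin d) (c : ℝ) {f : RSp d → ℂ} (hf : ContDiff ℝ ∞ f)
    (hc : HasCompactSupport f) :
    ∫ ξ in Set.Ioi (0 : ℝ), ft i c (shiftMul i c f) ξ = Complex.I * ft i c f 0 := by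
  have := integral_Ioi_of_hasDerivAt_of_tendsto' (a := 0) (fun ξ _ => hasDerivAt_ft i c hf hc ξ)
    ((integrable_ft i c (contDiff_shiftMul i c hf)
      (hasCompactSupport_shiftMul i c hc)).const_mul _).integrableOn
    (tendsto_ft i c hf hc Filter.tendsto_abs_atTop_atTop)
  rw [integral_const_mul] at this
  linear_combination (-Complex.I) * this + (∫ ξ in Set.Ioi (0 : ℝ), ft i c (shiftMul i c f) ξ) *
    Complex.I_mul_I

theorem integral_Iic_ft_shiftMul (i : Fin d) (c : ℝ) {f : RSp d → ℂ} (hf : ContDiff ℝ ∞ f)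
    (hc : HasCompactSupport f) :
    ∫ ξ in Set.Iic (0 : ℝ), ft i c (shiftMul i c f) ξ = -Complex.I * ft i c f 0 := by
  have := integral_Iic_of_hasDerivAt_of_tendsto' (a := 0) (fun ξ _ => hasDerivAt_ft i c hf hc ξ)
    ((integrable_ft i c (contDiff_shiftMul i c hf)
      (hasCompactSupport_shiftMul i c hc)).const_mul _).integrableOn
    (tendsto_ft i c hf hc Filter.tendsto_abs_atBot_atTop)
  rw [integral_const_mul] at this
  linear_combination (-Complex.I) * this + (∫ ξ in Set.Iic (0 : ℝ), ft i c (shiftMul i c f) ξ) *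
    Complex.I_mul_I

/-! ### The action of an operator on the Fourier side -/

/-- The coefficients of the derivative of the power series `∑_n b_n ξ^n`. -/
def derivSeq (b : ℕ → ℂ) : ℕ → ℂ := fun n => (n + 1) * b (n + 1)

/-- The symbol `∑_n b_n ξ^n`. -/
def symb (b : ℕ → ℂ) (ξ : ℝ) : ℂ := ∑' n, b n * (ξ : ℂ) ^ n

section

variable {k : Kind} {M : PosSeq} {Ω : TopologicalSpace.Opens (RSp d)}

/-- Termwise integration of `P(-D) φ` against a bounded factor. -/
theorem hasSum_integral_opSum (hM2 : CondM2 M.1) {b : ℕ → ℂ} (hb : IsUltraSeq k M.1 b)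
    (i : Fin d) (φ : TestSpace k M Ω) {G : RSp d → ℂ} (hG : Continuous G) :
    HasSum (fun n => b n * Complex.I ^ n * ∫ x, G x * (pd i)^[n] φ.1 x)
      (∫ x, G x * opSum i b φ.1 x) := by
  have hφ := contDiff_testSpace φ
  have hintg : ∀ n, Integrable fun x => G x * (pd i)^[n] φ.1 x := fun n =>
    (hG.mul (contDiff_pd_iterate i n hφ).continuous).integrable_of_hasCompactSupport
      (hasCompactSupport_pd_iterate i n φ.2.2.1).mul_left
  obtain ⟨w, hw, hwb⟩ := exists_summable_bound hM2 hb i φ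
  have hK : IsCompact (tsupport φ.1) := φ.2.2.1
  have hGK : IntegrableOn (fun x => ‖G x‖) (tsupport φ.1) :=
    hG.norm.continuousOn.integrableOn_compact hK
  have h := hasSum_integral_of_summable_integral_norm (μ := volume)
    (F := fun n x => b n * Complex.I ^ n * (G x * (pd i)^[n] φ.1 x))
    (fun n => (hintg n).const_mul _) ?_
  · have e : ∀ x, G x * opSum i b φ.1 x =
        ∑' n, b n * Complex.I ^ n * (G x * (pd i)^[n] φ.1 x) := by
      intro x
      rw [opSum, ← tsum_mul_left]
      refine tsum_congr fun n => ?_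
      rw [mpd_single hφ]
      ring
    simp_rw [e, ← integral_const_mul]
    exact h
  · refine Summable.of_nonneg_of_le (fun n => integral_nonneg fun x => norm_nonneg _) (fun n => ?_)
      (hw.mul_left (∫ x in tsupport φ.1, ‖G x‖))
    have hz : ∀ x, x ∉ tsupport φ.1 → ‖b n * Complex.I ^ n * (G x * (pd i)^[n] φ.1 x)‖ = 0 := by
      intro x hx
      rw [← mpd_single hφ, mpd_eq_zero hx, mul_zero, mul_zero, norm_zero]
    rw [← setIntegral_eq_integral_of_forall_compl_eq_zero hz, ← integral_mul_const]
    refine setIntegral_mono_on ((hintg n).const_mul _).norm.integrableOn (hGK.mul_const _)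
      hK.measurableSet fun x _ => ?_
    rw [← mul_assoc, mul_right_comm, norm_mul, mul_comm]
    have := hwb n x
    rw [mpd_single hφ] at this
    calc _ = ‖G x‖ * ‖b n * Complex.I ^ n * (pd i)^[n] φ.1 x‖ := by
          simp only [norm_mul]
      _ ≤ _ := mul_le_mul_of_nonneg_left this (norm_nonneg _)

theorem continuous_wave (i : Fin d) (c ξ : ℝ) : Continuous (wave (d := d) i c ξ) :=
  continuous_iff_continuousAt.2 fun x => (hasFDerivAt_wave i c ξ x).continuousAt

/-- With the kernel e^{+i(x_i-c)ξ}, integration by parts turns i∂_i into multiplication by ξ, so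
P(-D) becomes multiplication by the symbol P(ξ). -/
theorem ft_opSum (hM2 : CondM2 M.1) {b : ℕ → ℂ} (hb : IsUltraSeq k M.1 b)
    (i : Fin d) (c ξ : ℝ) (φ : TestSpace k M Ω) :
    ft i c (opSum i b φ.1) ξ = symb b ξ * ft i c φ.1 ξ := by
  have h := hasSum_integral_opSum hM2 hb i φ (continuous_wave i c ξ)
  rw [ft, ← h.tsum_eq, symb, ← tsum_mul_right]
  refine tsum_congr fun n => ?_
  have := ft_pd_iterate i c ξ n (contDiff_testSpace φ) φ.2.2.1
  rw [mul_assoc, mul_assoc, ← this]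
  rfl

/-- This is P(-D)((x_i - c)φ) = (x_i - c) P(-D)φ + i P'(-D)φ after Fourier transformation: the terms
n ∂_i^{n-1} φ of the product rule assemble to P'. Arguing term by term, one need not know that (x_i
- c)φ is again in `TestSpace`. -/
theorem ft_shiftMul_opSum (hM2 : CondM2 M.1) {b : ℕ → ℂ} (hb : IsUltraSeq k M.1 b)
    (hb' : IsUltraSeq k M.1 (derivSeq b)) (i : Fin d) (c ξ : ℝ)
    (hs : Summable fun n => b n * (ξ : ℂ) ^ n)
    (hs' : Summable fun n => derivSeq b n * (ξ : ℂ) ^ n) (φ : TestSpace k M Ω) :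
    ft i c (shiftMul i c (opSum i b φ.1)) ξ + Complex.I * ft i c (opSum i (derivSeq b) φ.1) ξ =
      symb b ξ * ft i c (shiftMul i c φ.1) ξ := by
  have hφ := contDiff_testSpace φ
  have hcφ : HasCompactSupport φ.1 := φ.2.2.1
  have hG : Continuous fun x : RSp d => wave i c ξ x * ((x i - c : ℝ) : ℂ) := by
    refine (continuous_wave i c ξ).mul ?_
    fun_prop
  have h := hasSum_integral_opSum hM2 hb i φ hG
  have e : ft i c (shiftMul i c (opSum i b φ.1)) ξ =
      ∫ x, wave i c ξ x * ((x i - c : ℝ) : ℂ) * opSum i b φ.1 x := by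
    simp only [ft, shiftMul, mul_assoc]
  have hterm : ∀ n, b n * Complex.I ^ n * ∫ x, wave i c ξ x * ((x i - c : ℝ) : ℂ) *
      (pd i)^[n] φ.1 x = b n * (ξ : ℂ) ^ n * ft i c (shiftMul i c φ.1) ξ -
        Complex.I * ((n * b n * (ξ : ℂ) ^ (n - 1)) * ft i c φ.1 ξ) := by
    intro n
    have h1 := ft_pd_iterate i c ξ n (contDiff_shiftMul i c hφ) (hasCompactSupport_shiftMul i c hcφ)
    have hintg : ∀ m, Integrable ((pd i)^[m] φ.1) := fun m =>
      (contDiff_pd_iterate i m hφ).continuous.integrable_of_hasCompactSupport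
        (hasCompactSupport_pd_iterate i m hcφ)
    have hintg' : Integrable (shiftMul i c ((pd i)^[n] φ.1)) :=
      (contDiff_shiftMul i c (contDiff_pd_iterate i n hφ)).continuous.integrable_of_hasCompactSupport
        (hasCompactSupport_shiftMul i c (hasCompactSupport_pd_iterate i n hcφ))
    have h2 : ft i c ((pd i)^[n] (shiftMul i c φ.1)) ξ =
        (∫ x, wave i c ξ x * ((x i - c : ℝ) : ℂ) * (pd i)^[n] φ.1 x) +
          n * ft i c ((pd i)^[n - 1] φ.1) ξ := by
      unfold ft
      rw [← integral_const_mul, ← integral_add]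
      · congr 1
        funext x
        rw [pd_iterate_shiftMul i c n hφ, shiftMul]
        ring
      · simpa only [shiftMul, mul_assoc] using integrable_wave_mul i c ξ hintg'
      · exact (integrable_wave_mul i c ξ (hintg _)).const_mul _
    rw [h2] at h1
    -- The truncated exponent n - 1 at n = 0 is harmless because it comes with the factor n.
    rcases n with _ | n
    · simp only [pow_zero, Nat.cast_zero] at h1 ⊢
      linear_combination b 0 * h1
    · have h3 := ft_pd_iterate i c ξ n hφ hcφ
      simp only [Nat.add_sub_cancel] at h1 ⊢
      linear_combination b (n + 1) * h1 - b (n + 1) * Complex.I * ((n + 1 : ℕ) : ℂ) * h3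
  have hs2 : HasSum (fun n : ℕ => n * b n * (ξ : ℂ) ^ (n - 1)) (symb (derivSeq b) ξ) := by
    rw [← hasSum_nat_add_iff' 1]
    simp only [Finset.range_one, Finset.sum_singleton, Nat.cast_zero, zero_mul, sub_zero,
      Nat.add_sub_cancel]
    simp only [Nat.cast_add, Nat.cast_one]
    exact hs'.hasSum
  have hsum := (hs.hasSum.mul_right (ft i c (shiftMul i c φ.1) ξ)).sub
    ((hs2.mul_right (ft i c φ.1 ξ)).mul_left Complex.I)
  simp only [hterm] at h
  rw [e, h.unique hsum, ft_opSum hM2 hb' i c ξ φ]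
  simp only [symb]
  ring

end

/-! ### Superpositions of waves -/

/-- `∫ (i ξ)^n e^{i (x_i - c) ξ} f(ξ) dξ`. -/
def waveInt (i : Fin d) (c : ℝ) (f : ℝ → ℂ) (n : ℕ) : RSp d → ℂ :=
  fun x => ∫ ξ, wave i c ξ x * ((Complex.I * ξ) ^ n * f ξ)

theorem integrable_moment {f : ℝ → ℂ} (hf : ∀ n : ℕ, Integrable fun ξ : ℝ => (ξ : ℂ) ^ n * f ξ)
    (n : ℕ) : Integrable fun ξ : ℝ => (Complex.I * ξ) ^ n * f ξ := by
  simp only [mul_pow, mul_assoc]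
  exact (hf n).const_mul _

/-- Each differentiation in x_i brings down a factor iξ, and integrability of all moments justifies
differentiating under the integral. -/
theorem hasFDerivAt_waveInt (i : Fin d) (c : ℝ) {f : ℝ → ℂ}
    (hf : ∀ n : ℕ, Integrable fun ξ : ℝ => (ξ : ℂ) ^ n * f ξ) (n : ℕ) (x : RSp d) :
    HasFDerivAt (waveInt i c f n) ((EuclideanSpace.proj i : RSp d →L[ℝ] ℝ).smulRight
      (waveInt i c f (n + 1) x)) x := by
  have h1 := hasDerivAt_osc (μ := volume) (s := fun ξ : ℝ => ξ) measurable_id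
    (integrable_moment hf n) (by
      refine ((integrable_moment hf (n + 1)).const_mul (-Complex.I)).congr
        (Filter.Eventually.of_forall fun ξ => ?_)
      simp only
      rw [pow_succ]
      linear_combination (-(ξ : ℂ) * ((Complex.I * ξ) ^ n * f ξ)) * Complex.I_mul_I) (x i - c)
  have := h1.hasFDerivAt.comp x (hasFDerivAt_coord i c x)
  have e : waveInt i c f n = (fun t : ℝ => ∫ ξ : ℝ, Complex.exp ((ξ * t : ℝ) * Complex.I) *
      ((Complex.I * ξ) ^ n * f ξ)) ∘ fun x : RSp d => x i - c := by
    funext y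
    simp only [waveInt, wave, Function.comp, mul_comm]
  rw [e]
  refine this.congr_fderiv ?_
  ext v
  simp only [waveInt, wave, ContinuousLinearMap.comp_apply,
    ContinuousLinearMap.toSpanSingleton_apply, ContinuousLinearMap.smulRight_apply]
  congr 1
  refine integral_congr_ae (Filter.Eventually.of_forall fun ξ => ?_)
  simp only
  rw [pow_succ, mul_comm ξ (x i - c)]
  ring

theorem norm_waveInt_le (i : Fin d) (c : ℝ) (f : ℝ → ℂ) (n : ℕ) (x : RSp d) :
    ‖waveInt i c f n x‖ ≤ ∫ ξ : ℝ, |ξ| ^ n * ‖f ξ‖ := by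
  refine (norm_integral_le_integral_norm _).trans (le_of_eq ?_)
  congr 1
  funext ξ
  rw [norm_mul, norm_wave, one_mul, norm_mul, norm_pow, norm_mul, Complex.norm_I, one_mul,
    Complex.norm_real, Real.norm_eq_abs]

/-- Fubini: a pairing with a superposition of waves becomes a pairing of its weight with the
transform. -/
theorem integral_waveInt_mul (i : Fin d) (c : ℝ) {f : ℝ → ℂ} (hf : Integrable f)
    {χ : RSp d → ℂ} (hχ : Integrable χ) :
    ∫ x, waveInt i c f 0 x * χ x = ∫ ξ, f ξ * ft i c χ ξ := by
  have h1 : ∀ x, waveInt i c f 0 x * χ x = ∫ ξ, wave i c ξ x * (χ x * f ξ) := by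
    intro x
    rw [waveInt, ← integral_mul_const]
    congr 1
    funext ξ
    ring
  have h2 : ∀ ξ, f ξ * ft i c χ ξ = ∫ x, wave i c ξ x * (χ x * f ξ) := by
    intro ξ
    rw [ft, ← integral_const_mul]
    congr 1
    funext x
    ring
  simp_rw [h1, h2]
  refine integral_integral_swap ?_
  refine (hχ.mul_prod hf).bdd_mul (c := 1) ?_ (Filter.Eventually.of_forall fun z => ?_)
  · refine Continuous.aestronglyMeasurable ?_
    simp only [wave]
    fun_prop
  · exact (norm_wave i c z.2 z.1).le

/-! ### Non-quasianalyticity: construction of bump functions -/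

/-- Once y_j < h, the quotient of the product by h^n no longer increases, so it is bounded by its
finitely many earlier values; their sum serves as `B`. -/
theorem exists_prod_le_pow {y : ℕ → ℝ} (hy : ∀ j, 0 ≤ y j) (hlim : Tendsto y atTop (nhds 0))
    {h : ℝ} (hh : 0 < h) : ∃ B : ℝ, 0 ≤ B ∧ ∀ n, ∏ j ∈ Finset.range n, y j ≤ B * h ^ n := by
  obtain ⟨J, hJ⟩ := eventually_atTop.1 (hlim.eventually (gt_mem_nhds hh))
  have hnn : ∀ n, 0 ≤ ∏ j ∈ Finset.range n, y j := fun n => Finset.prod_nonneg fun j _ => hy j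
  have hq : ∀ n, 0 ≤ (∏ j ∈ Finset.range n, y j) / h ^ n := fun n =>
    div_nonneg (hnn n) (by positivity)
  refine ⟨∑ n ∈ Finset.range (J + 1), (∏ j ∈ Finset.range n, y j) / h ^ n,
    Finset.sum_nonneg fun n _ => hq n, fun n => ?_⟩
  rw [← div_le_iff₀ (by positivity)]
  rcases le_total n J with hn | hn
  · exact Finset.single_le_sum (f := fun n => (∏ j ∈ Finset.range n, y j) / h ^ n)
      (fun m _ => hq m) (Finset.mem_range.2 (by omega))
  · have h1 : (∏ j ∈ Finset.range n, y j) / h ^ n ≤ (∏ j ∈ Finset.range J, y j) / h ^ J := by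
      induction n, hn using Nat.le_induction with
      | base => exact le_rfl
      | succ n hn ih =>
        refine le_trans ?_ ih
        rw [Finset.prod_range_succ, pow_succ, mul_div_mul_comm]
        refine mul_le_of_le_one_right (hq n) ?_
        rw [div_le_one hh]
        exact (hJ n hn).le
    exact h1.trans (Finset.single_le_sum (f := fun n => (∏ j ∈ Finset.range n, y j) / h ^ n)
      (fun m _ => hq m) (Finset.mem_range.2 (by omega)))

/-- Averaging lengths of small total length for which the derivatives of the iterated averages are
controlled by `M` in the Beurling sense. -/
theorem exists_averaging_lengths {M : ℕ → ℝ} (hM : ∀ p, 0 < M p) (hM3 : CondM3' M) {R : ℝ}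
    (hR : 0 < R) : ∃ c : ℕ → ℝ, (∀ j, 0 < c j) ∧ Summable c ∧
      (∀ k, ∑ j ∈ Finset.range k, c j ≤ R) ∧
      ∀ h : ℝ, 0 < h → ∃ B : ℝ, 0 ≤ B ∧ ∀ n, ∏ j ∈ Finset.range n, (2 / c j) ≤ B * h ^ n * M n := by
  set r : ℕ → ℝ := fun p => M p / M (p + 1) with hr
  have hr0 : ∀ p, 0 < r p := fun p => div_pos (hM _) (hM _)
  -- Dividing r_j by the square root of the tail t_j keeps the series summable, by telescoping of
  -- √t_j, while r_j becomes negligible against r_j / √t_j. The gain √t_j → 0 is what yields every h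
  -- > 0 and not only some h.
  set t : ℕ → ℝ := fun j => ∑' p, r (p + j) with ht
  have hsum : ∀ j, Summable fun p => r (p + j) := fun j => (summable_nat_add_iff j).2 hM3
  have ht0 : ∀ j, 0 < t j := fun j =>
    (hsum j).tsum_pos (fun p => (hr0 _).le) 0 (hr0 _)
  have htr : ∀ j, r j = t j - t (j + 1) := by
    intro j
    have := (hsum j).tsum_eq_zero_add
    simp only [zero_add] at this
    have e : t (j + 1) = ∑' p, r (p + 1 + j) := by
      simp only [ht]
      exact tsum_congr fun p => by rw [add_right_comm, add_assoc]
    rw [e]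
    simp only [ht]
    linarith
  have htlim : Tendsto t atTop (nhds 0) := tendsto_sum_nat_add r
  -- The telescoping bound for the total length is 2√(t 0); this factor rescales it to R.
  set δ : ℝ := R / (2 * √(t 0)) with hδ
  have hs0 : ∀ j, 0 < √(t j) := fun j => Real.sqrt_pos.2 (ht0 j)
  have hδ0 : 0 < δ := div_pos hR (by linarith [hs0 0])
  have hc0 : ∀ j, 0 < δ * (r j / √(t j)) := fun j => mul_pos hδ0 (div_pos (hr0 j) (hs0 j))
  have hstep : ∀ j, r j / √(t j) ≤ 2 * (√(t j) - √(t (j + 1))) := by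
    intro j
    rw [div_le_iff₀ (hs0 j), htr j]
    nlinarith [Real.sq_sqrt (ht0 j).le, Real.sq_sqrt (ht0 (j + 1)).le,
      sq_nonneg (√(t j) - √(t (j + 1)))]
  have hpart : ∀ k, ∑ j ∈ Finset.range k, δ * (r j / √(t j)) ≤ R := by
    intro k
    have h1 : ∑ j ∈ Finset.range k, r j / √(t j) ≤ 2 * √(t 0) := by
      calc ∑ j ∈ Finset.range k, r j / √(t j)
          ≤ ∑ j ∈ Finset.range k, 2 * (√(t j) - √(t (j + 1))) :=
            Finset.sum_le_sum fun j _ => hstep j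
        _ = 2 * (√(t 0) - √(t k)) := by
            rw [← Finset.mul_sum, Finset.sum_range_sub' fun j => √(t j)]
        _ ≤ 2 * √(t 0) := by linarith [hs0 k]
    rw [← Finset.mul_sum]
    calc _ ≤ δ * (2 * √(t 0)) := mul_le_mul_of_nonneg_left h1 hδ0.le
      _ = R := by
        rw [hδ]
        have := hs0 0
        field_simp
  refine ⟨fun j => δ * (r j / √(t j)), hc0, summable_of_sum_range_le (fun j => (hc0 j).le) hpart,
    hpart, fun h hh => ?_⟩
  obtain ⟨B, hB, hb⟩ := exists_prod_le_pow (y := fun j => 2 / δ * √(t j))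
    (fun j => mul_nonneg (by positivity) (hs0 j).le) (by
      have := (Real.continuous_sqrt.tendsto 0).comp htlim
      rw [Real.sqrt_zero] at this
      simpa using this.const_mul (2 / δ)) hh
  refine ⟨B / M 0, div_nonneg hB (hM 0).le, fun n => ?_⟩
  have hprod : ∏ j ∈ Finset.range n, (2 / (δ * (r j / √(t j)))) =
      (∏ j ∈ Finset.range n, 2 / δ * √(t j)) * (M n / M 0) := by
    induction n with
    | zero => simp [(hM 0).ne']
    | succ n ih =>
      rw [Finset.prod_range_succ, Finset.prod_range_succ, ih]
      have h1 := (hM 0).ne'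
      have h2 := (hM n).ne'
      have h3 := (hM (n + 1)).ne'
      have h4 := (hs0 n).ne'
      simp only [hr]
      field_simp
  rw [hprod]
  calc _ ≤ B * h ^ n * (M n / M 0) :=
        mul_le_mul_of_nonneg_right (hb n) (div_nonneg (hM n).le (hM 0).le)
    _ = _ := by ring

/-- The average of `f` over `[x - a, x]`. -/
def avg (a : ℝ) (f : ℝ → ℝ) : ℝ → ℝ := fun x => a⁻¹ * ∫ t in (x - a)..x, f t

theorem hasDerivAt_avg {a : ℝ} {f : ℝ → ℝ} (hf : Continuous f) (x : ℝ) :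
    HasDerivAt (avg a f) (a⁻¹ * (f x - f (x - a))) x := by
  have hi : ∀ u v, IntervalIntegrable f volume u v := fun u v => hf.intervalIntegrable u v
  have h1 : ∀ y, HasDerivAt (fun y => ∫ t in (0 : ℝ)..y, f t) (f y) y := fun y =>
    (hf.integral_hasStrictDerivAt 0 y).hasDerivAt
  have h2 : HasDerivAt (fun y => ∫ t in (0 : ℝ)..(y - a), f t) (f (x - a)) x :=
    (h1 (x - a)).comp_sub_const x a
  have e : avg a f = fun y => a⁻¹ * ((∫ t in (0 : ℝ)..y, f t) - ∫ t in (0 : ℝ)..(y - a), f t) := by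
    funext y
    rw [avg, intervalIntegral.integral_interval_sub_left (hi _ _) (hi _ _)]
  rw [e]
  exact ((h1 x).sub h2).const_mul _

theorem avg_deriv {a : ℝ} {f f' : ℝ → ℝ} (hf : ∀ x, HasDerivAt f (f' x) x) (hf' : Continuous f')
    (x : ℝ) : avg a f' x = a⁻¹ * (f x - f (x - a)) := by
  rw [avg, intervalIntegral.integral_eq_sub_of_hasDerivAt (fun y _ => hf y)
    (hf'.intervalIntegrable _ _)]

theorem avg_le {a C : ℝ} (ha : 0 < a) {f : ℝ → ℝ} (hf : ∀ x, |f x| ≤ C) (x : ℝ) :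
    |avg a f x| ≤ C := by
  have h := intervalIntegral.norm_integral_le_of_norm_le_const (a := x - a) (b := x) (f := f)
    (fun y _ => hf y)
  rw [sub_sub_cancel, abs_of_pos ha, Real.norm_eq_abs] at h
  rw [avg, abs_mul, abs_of_pos (inv_pos.2 ha), inv_mul_le_iff₀ ha, mul_comm]
  exact h

theorem avg_eq_const {a C x : ℝ} (ha : 0 < a) {f : ℝ → ℝ}
    (hf : ∀ y, x - a ≤ y → y ≤ x → f y = C) : avg a f x = C := by
  have : ∫ t in (x - a)..x, f t = ∫ t in (x - a)..x, C := by
    refine intervalIntegral.integral_congr fun y hy => ?_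
    rw [Set.uIcc_of_le (by linarith)] at hy
    exact hf y hy.1 hy.2
  rw [avg, this, intervalIntegral.integral_const, sub_sub_cancel, smul_eq_mul,
    inv_mul_cancel_left₀ ha.ne']

theorem abs_avg_sub_le {a C : ℝ} (ha : 0 < a) {f f' : ℝ → ℝ} (hf : ∀ x, HasDerivAt f (f' x) x)
    (hC : ∀ x, |f' x| ≤ C) (x : ℝ) : |avg a f x - f x| ≤ a * C := by
  have hcont : Continuous f := continuous_iff_continuousAt.2 fun x => (hf x).continuousAt
  have hlip : ∀ y, x - a ≤ y → y ≤ x → |f y - f x| ≤ a * C := by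
    intro y h1 h2
    have := Convex.norm_image_sub_le_of_norm_hasDerivWithin_le (f := f) (f' := f') (s := Set.univ)
      (fun z _ => (hf z).hasDerivWithinAt) (fun z _ => hC z) convex_univ (Set.mem_univ x)
      (Set.mem_univ y)
    rw [Real.norm_eq_abs, Real.norm_eq_abs] at this
    refine this.trans ?_
    rw [mul_comm]
    refine mul_le_mul_of_nonneg_right ?_ ((abs_nonneg _).trans (hC x))
    rw [abs_le]
    constructor <;> linarith
  have e : avg a f x - f x = a⁻¹ * ∫ t in (x - a)..x, (f t - f x) := by
    rw [intervalIntegral.integral_sub (hcont.intervalIntegrable _ _) (by simp),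
      intervalIntegral.integral_const, sub_sub_cancel, smul_eq_mul, mul_sub,
      inv_mul_cancel_left₀ ha.ne', avg]
  have h := intervalIntegral.norm_integral_le_of_norm_le_const (a := x - a) (b := x)
    (f := fun t => f t - f x) (C := a * C) (fun y hy => by
      rw [Set.uIoc_of_le (by linarith)] at hy
      exact hlip y hy.1.le hy.2)
  rw [sub_sub_cancel, abs_of_pos ha, Real.norm_eq_abs] at h
  rw [e, abs_mul, abs_of_pos (inv_pos.2 ha), inv_mul_le_iff₀ ha, mul_comm]
  exact h

/-- Iterated averages of the derivatives of `f`. -/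
def iterAvg (c : ℕ → ℝ) (g : ℕ → ℝ → ℝ) : ℕ → ℕ → ℝ → ℝ
  | 0 => g
  | k + 1 => fun n => avg (c k) (iterAvg c g k n)

section IterAvg

variable {c : ℕ → ℝ} {g : ℕ → ℝ → ℝ}

/-- Averaging commutes with differentiation: both orders give the difference quotient of f over the
averaging length. -/
theorem hasDerivAt_iterAvg (hg : ∀ n x, HasDerivAt (g n) (g (n + 1) x) x) (k : ℕ) :
    ∀ n x, HasDerivAt (iterAvg c g k n) (iterAvg c g k (n + 1) x) x := by
  induction k with
  | zero => exact hg
  | succ k ih =>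
    intro n x
    have hcont : ∀ n, Continuous (iterAvg c g k n) := fun n =>
      continuous_iff_continuousAt.2 fun x => (ih n x).continuousAt
    exact (hasDerivAt_avg (hcont n) x).congr_deriv (avg_deriv (ih n) (hcont (n + 1)) x).symm

theorem iterAvg_le (hc : ∀ j, 0 < c j) {S : ℕ → ℝ} (hS : ∀ n x, |g n x| ≤ S n) (k n : ℕ) :
    ∀ x, |iterAvg c g k n x| ≤ S n := by
  induction k with
  | zero => exact hS n
  | succ k ih => exact avg_le (hc k) ih

/-- Each derivative is spent on one average: the derivative of an average over length c_j is a
difference quotient, costing 2 / c_j in the supremum. Averages on which no derivative is spent do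
not increase the supremum. -/
theorem iterAvg_le_prod (hc : ∀ j, 0 < c j) (hg : ∀ n x, HasDerivAt (g n) (g (n + 1) x) x)
    {S : ℝ} (hS : ∀ x, |g 0 x| ≤ S) (k : ℕ) :
    ∀ n ≤ k, ∀ x, |iterAvg c g k n x| ≤ S * ∏ j ∈ Finset.range n, (2 / c j) := by
  induction k with
  | zero =>
    intro n hn x
    obtain rfl : n = 0 := by omega
    simpa [iterAvg] using hS x
  | succ k ih =>
    intro n hn x
    rcases Nat.lt_or_ge k n with h | h
    · obtain rfl : n = k + 1 := by omega
      have hcont : Continuous (iterAvg c g k (k + 1)) := continuous_iff_continuousAt.2 fun x =>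
        (hasDerivAt_iterAvg hg k (k + 1) x).continuousAt
      change |avg (c k) (iterAvg c g k (k + 1)) x| ≤ _
      rw [avg_deriv (hasDerivAt_iterAvg hg k k) hcont, abs_mul, abs_of_pos (inv_pos.2 (hc k)),
        Finset.prod_range_succ]
      have h1 := ih k le_rfl x
      have h2 := ih k le_rfl (x - c k)
      have h3 := abs_sub (iterAvg c g k k x) (iterAvg c g k k (x - c k))
      rw [inv_mul_le_iff₀ (hc k)]
      have h4 := (hc k).ne'
      have : c k * (S * ((∏ j ∈ Finset.range k, 2 / c j) * (2 / c k))) =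
          2 * (S * ∏ j ∈ Finset.range k, 2 / c j) := by
        field_simp
      linarith
    · exact avg_le (hc k) (ih n h) x

/-- Consecutive iterates differ by a multiple of c_k depending only on n. Summability of c therefore
gives uniform convergence of the iterates together with all derivatives. -/
theorem iterAvg_sub_le (hc : ∀ j, 0 < c j) (hg : ∀ n x, HasDerivAt (g n) (g (n + 1) x) x)
    {S : ℕ → ℝ} (hS : ∀ n x, |g n x| ≤ S n) (k n : ℕ) (x : ℝ) :
    |iterAvg c g (k + 1) n x - iterAvg c g k n x| ≤ c k * S (n + 1) :=
  abs_avg_sub_le (hc k) (hasDerivAt_iterAvg hg k n) (iterAvg_le hc hS k (n + 1)) x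

theorem iterAvg_nonneg (hc : ∀ j, 0 < c j) (h0 : ∀ x, 0 ≤ g 0 x) (k : ℕ) :
    ∀ x, 0 ≤ iterAvg c g k 0 x := by
  induction k with
  | zero => exact h0
  | succ k ih =>
    intro x
    exact mul_nonneg (inv_pos.2 (hc k)).le
      (intervalIntegral.integral_nonneg (by linarith [hc k]) fun y _ => ih y)

/-- The averages look only to the left, so an interval of constancy shrinks only at its left end, by
the total averaging length. -/
theorem iterAvg_eq_const (hc : ∀ j, 0 < c j) {u v C : ℝ} (h : ∀ x, u ≤ x → x ≤ v → g 0 x = C)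
    (k : ℕ) : ∀ x, u + ∑ j ∈ Finset.range k, c j ≤ x → x ≤ v → iterAvg c g k 0 x = C := by
  induction k with
  | zero =>
    intro x h1 h2
    exact h x (by simpa using h1) h2
  | succ k ih =>
    intro x h1 h2
    rw [Finset.sum_range_succ] at h1
    exact avg_eq_const (hc k) fun y hy1 hy2 => ih y (by linarith) (by linarith)

end IterAvg

/-- A smooth bump function on the line, together with its derivatives, in the Beurling class. -/
theorem exists_bump {M : ℕ → ℝ} (hM : ∀ p, 0 < M p) (hM3 : CondM3' M) {r : ℝ} (hr : 0 < r) :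
    ∃ G : ℕ → ℝ → ℝ, (∀ n x, HasDerivAt (G n) (G (n + 1) x) x) ∧ (∀ x, 0 ≤ G 0 x) ∧ G 0 0 = 1 ∧
      (∀ x, r ≤ |x| → G 0 x = 0) ∧
      ∀ h : ℝ, 0 < h → ∃ B : ℝ, 0 ≤ B ∧ ∀ n x, |G n x| ≤ B * (h ^ n * M n) := by
  obtain ⟨c, hc, hcs, hcR, hcM⟩ := exists_averaging_lengths hM hM3 (R := r / 3) (by positivity)
  -- The starting bump is 1 up to r/3 and 0 from 2r/3 on; the averages have total length at most
  -- r/3, which leaves the value at 0 and the vanishing for |x| ≥ r intact.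
  let f : ContDiffBump (0 : ℝ) := ⟨r / 3, 2 * r / 3, by positivity, by linarith⟩
  have hfs : ContDiff ℝ ∞ f := f.contDiff
  set g : ℕ → ℝ → ℝ := fun n => iteratedDeriv n f with hgdef
  have hg : ∀ n x, HasDerivAt (g n) (g (n + 1) x) x := by
    intro n x
    simp only [hgdef, iteratedDeriv_succ]
    exact ((hfs.differentiable_iteratedDeriv n (mod_cast ENat.natCast_lt_top n)) x).hasDerivAt
  have hgc : ∀ n, HasCompactSupport (g n) := by
    intro n
    induction n with
    | zero =>
      simp only [hgdef, iteratedDeriv_zero]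
      exact f.hasCompactSupport
    | succ n ih =>
      simp only [hgdef, iteratedDeriv_succ]
      exact ih.deriv
  have hS : ∃ S : ℕ → ℝ, ∀ n x, |g n x| ≤ S n := by
    have : ∀ n, ∃ C, ∀ x, ‖g n x‖ ≤ C := fun n =>
      (hgc n).exists_bound_of_continuous
        (continuous_iff_continuousAt.2 fun x => (hg n x).continuousAt)
    choose S hS using this
    exact ⟨S, hS⟩
  obtain ⟨S, hS⟩ := hS
  have hg0 : ∀ x, g 0 x = f x := fun x => by simp [hgdef]
  set D : ℕ → ℕ → ℝ → ℝ := fun n k x => iterAvg c g (k + 1) n x - iterAvg c g k n x with hD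
  have hDle : ∀ n k x, ‖D n k x‖ ≤ c k * S (n + 1) := fun n k x => iterAvg_sub_le hc hg hS k n x
  have hDs : ∀ n, Summable fun k => c k * S (n + 1) := fun n => hcs.mul_right _
  have hlim : ∀ n x, Tendsto (fun k => iterAvg c g k n x) atTop
      (nhds (g n x + ∑' k, D n k x)) := by
    intro n x
    have := ((hDs n).of_norm_bounded fun k => hDle n k x).hasSum.tendsto_sum_nat.const_add (g n x)
    refine this.congr fun k => ?_
    rw [Finset.sum_range_sub fun k => iterAvg c g k n x]
    simp [iterAvg]
  refine ⟨fun n x => g n x + ∑' k, D n k x, ?_, ?_, ?_, ?_, ?_⟩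
  · intro n x
    refine (hg n x).add ?_
    refine hasDerivAt_tsum (hDs (n + 1)) (fun k y => ?_) (fun k y => hDle (n + 1) k y)
      (y₀ := 0) ((hDs n).of_norm_bounded fun k => hDle n k 0) x
    exact (hasDerivAt_iterAvg hg (k + 1) n y).sub (hasDerivAt_iterAvg hg k n y)
  · intro x
    exact ge_of_tendsto' (hlim 0 x) fun k =>
      iterAvg_nonneg hc (fun y => by rw [hg0]; exact f.nonneg) k x
  · refine tendsto_nhds_unique (hlim 0 0) (tendsto_const_nhds.congr fun k => ?_)
    refine (iterAvg_eq_const hc (u := -(r / 3)) (v := r / 3) (C := 1) (fun x h1 h2 => ?_) k 0 ?_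
      (by positivity)).symm
    · rw [hg0]
      refine f.one_of_mem_closedBall ?_
      rw [mem_closedBall_zero_iff, Real.norm_eq_abs]
      exact abs_le.2 ⟨h1, h2⟩
    · linarith [hcR k]
  · intro x hx
    have hz : ∀ y, 2 * r / 3 ≤ |y| → g 0 y = 0 := by
      intro y hy
      rw [hg0]
      exact f.zero_of_le_dist (by simpa using hy)
    refine tendsto_nhds_unique (hlim 0 x) (tendsto_const_nhds.congr fun k => ?_)
    rcases le_abs.1 hx with h | h
    · refine (iterAvg_eq_const hc (u := 2 * r / 3) (v := x) (C := 0) (fun y h1 _ => hz y ?_) k x ?_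
        le_rfl).symm
      · exact h1.trans (le_abs_self y)
      · linarith [hcR k]
    · refine (iterAvg_eq_const hc (u := x - r / 3) (v := x) (C := 0) (fun y _ h2 => hz y ?_) k x ?_
        le_rfl).symm
      · refine le_trans ?_ (neg_le_abs y)
        linarith
      · linarith [hcR k]
  · intro h hh
    obtain ⟨B, hB, hb⟩ := hcM h hh
    have hS0 : 0 ≤ S 0 := (abs_nonneg _).trans (hS 0 0)
    refine ⟨S 0 * B, mul_nonneg hS0 hB, fun n x => ?_⟩
    refine le_of_tendsto (hlim n x).abs ?_
    -- The product bound for the n-th derivative needs at least n averages, which is no restriction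
    -- in the limit.
    filter_upwards [eventually_ge_atTop n] with k hk
    refine (iterAvg_le_prod hc hg (hS 0) k n hk x).trans ?_
    rw [mul_assoc]
    refine mul_le_mul_of_nonneg_left ?_ hS0
    rw [← mul_assoc]
    exact hb n

/-! ### A test function that is not annihilated by the delta functional on a hyperplane -/

/-- Log-convexity says that the ratios M_{p+1} / M_p increase; telescoping from M_0 = 1 gives the
inequality. It lets products of one-dimensional bounds be estimated by M_{|α|}. -/
theorem CondM1.mul_le {M : ℕ → ℝ} (hM : ∀ p, 0 < M p) (hM0 : M 0 = 1) (hM1 : CondM1 M) (p q : ℕ) :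
    M p * M q ≤ M (p + q) := by
  have hmono : Monotone fun p => M (p + 1) / M p := by
    refine monotone_nat_of_le_succ fun p => ?_
    rw [div_le_div_iff₀ (hM _) (hM _)]
    have := hM1 p
    simp only [add_assoc] at this ⊢
    norm_num at this ⊢
    nlinarith
  induction p with
  | zero => simp [hM0]
  | succ p ih =>
    have h1 : M (p + 1) / M p ≤ M (p + q + 1) / M (p + q) := hmono (by omega)
    have h2 : M (p + 1) = M (p + 1) / M p * M p := (div_mul_cancel₀ _ (hM p).ne').symm
    have h3 : M (p + 1 + q) = M (p + q + 1) / M (p + q) * M (p + q) := by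
      rw [div_mul_cancel₀ _ (hM _).ne', add_right_comm]
    rw [h2, h3, mul_assoc]
    exact mul_le_mul h1 ih (mul_pos (hM _) (hM _)).le (div_pos (hM _) (hM _)).le

theorem CondM1.prod_le {M : ℕ → ℝ} (hM : ∀ p, 0 < M p) (hM0 : M 0 = 1) (hM1 : CondM1 M)
    {ι : Type*} (s : Finset ι) (p : ι → ℕ) : ∏ j ∈ s, M (p j) ≤ M (∑ j ∈ s, p j) := by
  classical
  induction s using Finset.induction_on with
  | empty => simp [hM0]
  | insert a s ha ih =>
    rw [Finset.prod_insert ha, Finset.sum_insert ha]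
    exact (mul_le_mul_of_nonneg_left ih (hM _).le).trans (hM1.mul_le hM hM0 _ _)

/-! ### Test functions as products of one-dimensional bumps. -/

/-- The product of one-dimensional functions centred at the coordinates of `y`. -/
def prodTower (G : ℕ → ℝ → ℝ) (y : RSp d) (β : Fin d →₀ ℕ) : RSp d → ℂ :=
  fun x => ∏ j, (G (β j) (x j - y j) : ℂ)

theorem isTower_prodTower {G : ℕ → ℝ → ℝ} (hG : ∀ n x, HasDerivAt (G n) (G (n + 1) x) x)
    (y : RSp d) : IsTower (prodTower G y) := by
  have hfac : ∀ (β : Fin d →₀ ℕ) (j : Fin d) (x : RSp d),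
      HasFDerivAt (fun x : RSp d => (G (β j) (x j - y j) : ℂ))
        ((EuclideanSpace.proj j : RSp d →L[ℝ] ℝ).smulRight (G (β j + 1) (x j - y j) : ℂ)) x := by
    intro β j x
    have h1 := (hG (β j) (x j - y j)).ofReal_comp.hasFDerivAt.comp x (hasFDerivAt_coord j (y j) x)
    refine h1.congr_fderiv ?_
    ext v
    simp
  have key : ∀ β x, HasFDerivAt (prodTower G y β) (∑ i, (∏ j ∈ Finset.univ.erase i,
      (G (β j) (x j - y j) : ℂ)) • (EuclideanSpace.proj i : RSp d →L[ℝ] ℝ).smulRight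
        (G (β i + 1) (x i - y i) : ℂ)) x := fun β x =>
    HasFDerivAt.finsetProd (u := Finset.univ) fun j _ => hfac β j x
  refine ⟨fun β x => (key β x).differentiableAt, fun β i => ?_⟩
  funext x
  rw [pd, (key β x).fderiv, prodTower, ← Finset.mul_prod_erase _ _ (Finset.mem_univ i)]
  simp only [sum_apply, smul_apply,
    ContinuousLinearMap.smulRight_apply]
  rw [Finset.sum_eq_single i]
  · have : ∏ j ∈ Finset.univ.erase i, (G ((β + Finsupp.single i 1 : Fin d →₀ ℕ) j) (x j - y j) : ℂ)
        = ∏ j ∈ Finset.univ.erase i, (G (β j) (x j - y j) : ℂ) := by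
      refine Finset.prod_congr rfl fun j hj => ?_
      simp [(Finset.ne_of_mem_erase hj).symm]
    rw [this]
    simp [mul_comm]
  · intro j _ hj
    simp [hj]
  · simp

theorem norm_le_sum_coord (x : RSp d) : ‖x‖ ≤ ∑ j, |x j| := by
  have hx : x = ∑ i, x i • (EuclideanSpace.single i (1 : ℝ) : RSp d) := by
    ext j
    simp [Pi.single_apply]
  conv_lhs => rw [hx]
  refine (norm_sum_le _ _).trans (Finset.sum_le_sum fun j _ => ?_)
  simp [norm_smul]

section

variable {M : PosSeq} {Ω : TopologicalSpace.Opens (RSp d)}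

theorem prodTower_mem (k : Kind) (hM0 : M.1 0 = 1) (hM1 : CondM1 M.1) {G : ℕ → ℝ → ℝ}
    (hG : ∀ n x, HasDerivAt (G n) (G (n + 1) x) x)
    (hb : ∀ h : ℝ, 0 < h → ∃ B : ℝ, 0 ≤ B ∧ ∀ n x, |G n x| ≤ B * (h ^ n * M.1 n))
    {r : ℝ} (hs : ∀ x, r ≤ |x| → G 0 x = 0) {y : RSp d}
    (hy : Metric.closedBall y (d * r) ⊆ Ω) : prodTower G y 0 ∈ TestSpace k M Ω := by
  have hT := isTower_prodTower hG y
  have hsupp : tsupport (prodTower G y 0) ⊆ Metric.closedBall y (d * r) := by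
    refine closure_minimal (fun x hx => ?_) Metric.isClosed_closedBall
    rw [Metric.mem_closedBall, dist_eq_norm]
    refine (norm_le_sum_coord _).trans ?_
    calc ∑ j, |(x - y) j| ≤ ∑ _j : Fin d, r := by
          refine Finset.sum_le_sum fun j _ => ?_
          by_contra hj
          refine hx (Finset.prod_eq_zero (Finset.mem_univ j) ?_)
          rw [Finsupp.zero_apply, hs (x j - y j) (not_le.1 hj).le, Complex.ofReal_zero]
      _ = d * r := by simp
  have hbound : ∀ h : ℝ, 0 < h → ∃ B : ℝ, 0 ≤ B ∧ NormLE M.1 h Set.univ (prodTower G y 0) B := by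
    intro h hh
    obtain ⟨B, hB, hGB⟩ := hb h hh
    refine ⟨B ^ d, by positivity, fun x _ α => ?_⟩
    rw [hT.mpd_eq, zero_add, prodTower, norm_prod]
    calc ∏ j, ‖(G (α j) (x j - y j) : ℂ)‖ ≤ ∏ j, (B * (h ^ α j * M.1 (α j))) := by
          refine Finset.prod_le_prod (fun j _ => norm_nonneg _) fun j _ => ?_
          rw [Complex.norm_real]
          exact hGB _ _
      _ = B ^ d * (h ^ α.degree * ∏ j, M.1 (α j)) := by
          rw [Finset.prod_mul_distrib, Finset.prod_mul_distrib, Finset.prod_const,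
            Finset.card_univ, Fintype.card_fin, Finset.prod_pow_eq_pow_sum,
            Finsupp.degree_eq_sum]
      _ ≤ _ := by
          rw [Finsupp.degree_eq_sum]
          gcongr
          exact hM1.prod_le M.2 hM0 _ _
  refine ⟨⟨(hT.contDiff 0).contDiffOn, fun K _ _ => ?_⟩,
    (isCompact_closedBall y (d * r)).of_isClosed_subset (isClosed_tsupport _) hsupp,
    hsupp.trans hy⟩
  cases k with
  | beurling =>
    intro h hh
    obtain ⟨B, hB, hn⟩ := hbound h hh
    exact ⟨B, hB, fun x _ => hn x (Set.mem_univ x)⟩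
  | roumieu =>
    obtain ⟨B, hB, hn⟩ := hbound 1 one_pos
    exact ⟨1, one_pos, B, hB, fun x _ => hn x (Set.mem_univ x)⟩

/-- The wave depends on x_i alone, so Fubini leaves a one-dimensional transform times the masses of
the other factors. -/
theorem ft_prodTower (G : ℕ → ℝ → ℝ) (y : RSp d) (i : Fin d) (ξ : ℝ) :
    ft i (y i) (prodTower G y 0) ξ = (∫ t : ℝ, Complex.exp ((t * ξ : ℝ) * Complex.I) * G 0 t) *
      (∏ _j ∈ Finset.univ.erase i, ∫ t : ℝ, (G 0 t : ℂ)) := by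
  let F : Fin d → ℝ → ℂ := fun j t =>
    (if j = i then Complex.exp (((t - y i) * ξ : ℝ) * Complex.I) else 1) * G 0 (t - y j)
  have e : ∀ x : RSp d, wave i (y i) ξ x * prodTower G y 0 x =
      (fun z : Fin d → ℝ => ∏ j, F j (z j)) ((MeasurableEquiv.toLp 2 (Fin d → ℝ)).symm x) := by
    intro x
    simp only [F, Finset.prod_mul_distrib, Finset.prod_ite_eq', Finset.mem_univ, if_true]
    rfl
  have h1 := (EuclideanSpace.volume_preserving_symm_measurableEquiv_toLp (Fin d)).integral_comp'
    fun z : Fin d → ℝ => ∏ j, F j (z j)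
  rw [ft]
  simp_rw [e]
  rw [h1, volume_pi, integral_fintype_prod_eq_prod, ← Finset.mul_prod_erase _ _ (Finset.mem_univ i)]
  congr 1
  · have := integral_sub_right_eq_self (μ := volume)
      (fun t : ℝ => Complex.exp ((t * ξ : ℝ) * Complex.I) * G 0 t) (y i)
    rw [← this]
    simp [F]
  · refine Finset.prod_congr rfl fun j hj => ?_
    have := integral_sub_right_eq_self (μ := volume) (fun t : ℝ => (G 0 t : ℂ)) (y j)
    rw [← this]
    simp [F, Finset.ne_of_mem_erase hj]

open FourierTransform in
/-- Fourier inversion at the origin, in the normalization without `2π` in the exponent. -/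
theorem integral_osc_eq {g : ℝ → ℂ} (hg : Continuous g) (hgi : Integrable g)
    (hJ : Integrable fun ξ : ℝ => ∫ t : ℝ, Complex.exp ((t * ξ : ℝ) * Complex.I) * g t) :
    ∫ ξ : ℝ, ∫ t : ℝ, Complex.exp ((t * ξ : ℝ) * Complex.I) * g t = 2 * Real.pi * g 0 := by
  set J : ℝ → ℂ := fun ξ => ∫ t : ℝ, Complex.exp ((t * ξ : ℝ) * Complex.I) * g t with hJdef
  have hπ : (-(2 * Real.pi)) ≠ 0 := neg_ne_zero.2 (by positivity)
  -- `𝓕` has the exponent -2πi t w; the substitution ξ = -2πw is the source of the factor 2π.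
  have hF : 𝓕 g = fun w => J (-(2 * Real.pi) * w) := by
    funext w
    rw [Real.fourier_eq']
    simp only [hJdef]
    congr 1
    funext t
    rw [smul_eq_mul]
    congr 3
    simp only [RCLike.inner_apply, conj_trivial]
    push_cast
    ring
  have hFi : Integrable (𝓕 g) := by
    rw [hF]
    exact hJ.comp_mul_left' hπ
  have hinv := congrFun (hg.fourierInv_fourier_eq hgi hFi) 0
  rw [Real.fourierInv_eq'] at hinv
  simp only [inner_zero_right, mul_zero, Complex.ofReal_zero, zero_mul, Complex.exp_zero,
    one_smul] at hinv
  rw [hF, Measure.integral_comp_mul_left] at hinv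
  rw [← hinv]
  have hp : (Real.pi : ℂ) ≠ 0 := by exact_mod_cast Real.pi_ne_zero
  rw [abs_inv, abs_neg, abs_of_pos (by positivity), Complex.real_smul]
  push_cast
  field_simp

/-- There is a test function on which the functional `φ ↦ ∫∫ e^{i (x_i - y_i) ξ} φ(x) dx dξ` does
not vanish. -/
theorem exists_testSpace_integral_ft_ne_zero (k : Kind) (hM0 : M.1 0 = 1) (hM1 : CondM1 M.1)
    (hM3 : CondM3' M.1) {y : RSp d} (hy : y ∈ Ω) (i : Fin d) :
    ∃ φ : TestSpace k M Ω, ∫ ξ, ft i (y i) φ.1 ξ ≠ 0 := by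
  obtain ⟨ε, hε, hball⟩ := Metric.isOpen_iff.1 Ω.isOpen y hy
  -- With this radius the support lies in a ball of radius d r < ε.
  obtain ⟨G, hG, hG0, hG1, hGs, hGb⟩ := exists_bump M.2 hM3 (r := ε / (d + 1)) (by positivity)
  have hmem : prodTower G y 0 ∈ TestSpace k M Ω := by
    refine prodTower_mem k hM0 hM1 hG hGb hGs
      ((Metric.closedBall_subset_ball ?_).trans hball)
    rw [mul_div_assoc', div_lt_iff₀ (by positivity)]
    nlinarith
  have hcont : Continuous (G 0) := continuous_iff_continuousAt.2 fun x => (hG 0 x).continuousAt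
  have hcomp : HasCompactSupport (G 0) := by
    refine HasCompactSupport.of_support_subset_isCompact
      (isCompact_closedBall (0 : ℝ) (ε / (d + 1))) fun x hx => ?_
    rw [mem_closedBall_zero_iff, Real.norm_eq_abs]
    by_contra h
    exact hx (hGs x (not_le.1 h).le)
  have hV : 0 < ∫ t, G 0 t :=
    hcont.integral_pos_of_hasCompactSupport_nonneg_nonzero hcomp hG0 (x := 0) (by simp [hG1])
  have hW : (∏ _j ∈ Finset.univ.erase i, ∫ t : ℝ, (G 0 t : ℂ)) ≠ 0 := by
    refine Finset.prod_ne_zero_iff.2 fun j _ => ?_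
    rw [integral_complex_ofReal]
    exact_mod_cast hV.ne'
  have hft : (fun ξ => ft i (y i) (prodTower G y 0) ξ) = _ := funext fun ξ => ft_prodTower G y i ξ
  have hintg := integrable_ft i (y i) ((isTower_prodTower hG y).contDiff 0) hmem.2.1
  rw [show ft i (y i) (prodTower G y 0) = _ from hft] at hintg
  refine ⟨⟨_, hmem⟩, ?_⟩
  change ∫ ξ, ft i (y i) (prodTower G y 0) ξ ≠ 0
  have hcontC : Continuous fun t => (G 0 t : ℂ) := Complex.continuous_ofReal.comp hcont
  -- The one-dimensional transform inherits integrability from the d-dimensional one, since the two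
  -- differ by a nonzero constant factor.
  have hJ := (integrable_mul_const_iff (IsUnit.mk0 _ hW) _).1 hintg
  simp_rw [ft_prodTower]
  rw [integral_mul_const, integral_osc_eq hcontC
    (hcont.integrable_of_hasCompactSupport hcomp).ofReal hJ]
  refine mul_ne_zero ?_ hW
  rw [hG1]
  have hp : (Real.pi : ℂ) ≠ 0 := by exact_mod_cast Real.pi_ne_zero
  simp [hp]

end

/-! ### Weight sequences -/

theorem CondM3'.exists_ratio_le {M : ℕ → ℝ} (hM : ∀ p, 0 < M p) (hM3 : CondM3' M) :
    ∃ S : ℝ, 0 < S ∧ ∀ n, M n ≤ S * M (n + 1) := by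
  have hpos : ∀ n, 0 < M n / M (n + 1) := fun n => div_pos (hM _) (hM _)
  refine ⟨∑' n, M n / M (n + 1), hM3.tsum_pos (fun n => (hpos n).le) 0 (hpos 0), fun n => ?_⟩
  rw [← div_le_iff₀ (hM _)]
  exact hM3.le_tsum n fun j _ => (hpos j).le

/-- Ratio test: consecutive quotients are t M_n / M_{n+1}, and (M.3)' sends them to 0. Hence symbols
converge at every real frequency. -/
theorem CondM3'.summable_pow_div {M : ℕ → ℝ} (hM : ∀ p, 0 < M p) (hM3 : CondM3' M) {t : ℝ}
    (ht : 0 < t) : Summable fun n => t ^ n / M n := by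
  refine summable_of_ratio_test_tendsto_lt_one (l := 0) one_pos
    (Eventually.of_forall fun n => (div_pos (pow_pos ht n) (hM n)).ne') ?_
  have h := hM3.tendsto_atTop_zero.const_mul t
  rw [mul_zero] at h
  refine h.congr fun n => ?_
  rw [Real.norm_of_nonneg (div_pos (pow_pos ht _) (hM _)).le,
    Real.norm_of_nonneg (div_pos (pow_pos ht _) (hM _)).le]
  have h1 := (hM n).ne'
  have h2 := (hM (n + 1)).ne'
  field_simp
  ring

theorem CondM2.condM2' {M : ℕ → ℝ} (hM : ∀ p, 0 < M p) (hM2 : CondM2 M) : CondM2' M := by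
  obtain ⟨A, H, hA, hH, h⟩ := hM2
  refine ⟨max 1 (A * H * M 1), H, le_max_left _ _, hH, fun p => ?_⟩
  have hp := hM p
  calc M (p + 1) ≤ A * H ^ (p + 1) * M p * M 1 := h p 1
    _ = A * H * M 1 * (H ^ p * M p) := by ring
    _ ≤ max 1 (A * H * M 1) * (H ^ p * M p) := by
        gcongr
        exact le_max_right _ _
    _ = _ := by ring

/-- `M_p ≤ C l^p N_p` for some `l` and `C`. -/
def WeakPrec (M N : ℕ → ℝ) : Prop :=
  ∃ l : ℝ, 0 < l ∧ ∃ C : ℝ, 0 < C ∧ ∀ p, M p ≤ C * l ^ p * N p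

theorem Prec.weakPrec {M N : ℕ → ℝ} (h : Prec M N) : WeakPrec M N :=
  ⟨1, one_pos, h 1 one_pos⟩

theorem WeakPrec.refl (M : ℕ → ℝ) : WeakPrec M M :=
  ⟨1, one_pos, 1, one_pos, fun p => by simp⟩

/-- The shifts of `Q` needed to estimate moments are dominated by `Q`. -/
theorem exists_shift_bound {M Q : ℕ → ℝ} (hM : ∀ p, 0 < M p) (hQ : ∀ p, 0 < Q p) (hM3 : CondM3' M)
    (hMQ : WeakPrec M Q) (hQ2 : CondM2' Q) : ∃ B h : ℝ, 0 < B ∧ 0 < h ∧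
      ∀ n, Q 0 + Q (n + 2) + Q (n + 3) ≤ B * (h ^ n * Q n) := by
  obtain ⟨S, hS, hr⟩ := hM3.exists_ratio_le hM
  obtain ⟨l, hl, C, hC, hle⟩ := hMQ
  obtain ⟨A, H, hA, hH, h2⟩ := hQ2
  have hlow : ∀ n, M 0 ≤ S ^ n * M n := by
    intro n
    induction n with
    | zero => simp
    | succ n ih =>
      refine ih.trans ?_
      rw [pow_succ, mul_assoc]
      exact mul_le_mul_of_nonneg_left (hr n) (by positivity)
  have hQlow : ∀ n, Q 0 ≤ Q 0 / M 0 * C * ((S * l) ^ n * Q n) := by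
    intro n
    have h0 := hM 0
    have hq := hQ 0
    calc Q 0 = Q 0 / M 0 * M 0 := by field_simp
      _ ≤ Q 0 / M 0 * (S ^ n * (C * l ^ n * Q n)) := by
          gcongr
          exact (hlow n).trans (mul_le_mul_of_nonneg_left (hle n) (by positivity))
      _ = _ := by
          rw [mul_pow]
          ring
  have h2' : ∀ n, Q (n + 2) ≤ A ^ 2 * H * ((H ^ 3) ^ n * Q n) := by
    intro n
    have hq := hQ n
    calc Q (n + 2) ≤ A * H ^ (n + 1) * (A * H ^ n * Q n) :=
          (h2 (n + 1)).trans (mul_le_mul_of_nonneg_left (h2 n) (by positivity))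
      _ = A ^ 2 * H * ((H ^ 2) ^ n * Q n) := by
          rw [← pow_mul]
          ring
      _ ≤ _ := by
          gcongr
          norm_num
  have h3' : ∀ n, Q (n + 3) ≤ A ^ 3 * H ^ 3 * ((H ^ 3) ^ n * Q n) := by
    intro n
    have hq := hQ n
    have hq1 := hQ (n + 1)
    calc Q (n + 3) ≤ A * H ^ (n + 2) * (A * H ^ (n + 1) * (A * H ^ n * Q n)) := by
          refine (h2 (n + 2)).trans (mul_le_mul_of_nonneg_left ?_ (by positivity))
          exact (h2 (n + 1)).trans (mul_le_mul_of_nonneg_left (h2 n) (by positivity))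
      _ = _ := by
          rw [← pow_mul]
          ring
  have hq0 := hQ 0
  have hm0 := hM 0
  refine ⟨Q 0 / M 0 * C + A ^ 2 * H + A ^ 3 * H ^ 3, max (S * l) (H ^ 3), by positivity,
    lt_max_of_lt_left (by positivity), fun n => ?_⟩
  have hq := hQ n
  have e1 : (S * l) ^ n * Q n ≤ max (S * l) (H ^ 3) ^ n * Q n := by
    gcongr
    exact le_max_left _ _
  have e2 : (H ^ 3) ^ n * Q n ≤ max (S * l) (H ^ 3) ^ n * Q n := by
    gcongr
    exact le_max_right _ _
  rw [add_mul, add_mul]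
  refine add_le_add (add_le_add ?_ ?_) ?_
  · exact (hQlow n).trans (mul_le_mul_of_nonneg_left e1 (by positivity))
  · exact (h2' n).trans (mul_le_mul_of_nonneg_left e2 (by positivity))
  · exact (h3' n).trans (mul_le_mul_of_nonneg_left e2 (by positivity))

/-- The geometric mean of two weight sequences. -/
def geomMean (M N : ℕ → ℝ) : ℕ → ℝ := fun p => √(M p * N p)

section GeomMean

variable {M N : ℕ → ℝ}

theorem geomMean_pos (hM : ∀ p, 0 < M p) (hN : ∀ p, 0 < N p) (p : ℕ) : 0 < geomMean M N p :=
  Real.sqrt_pos.2 (mul_pos (hM p) (hN p))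

/-- The square root halves the gap: the hypothesis at l² gives the conclusion at l. The mean thus
lies strictly between M and N in the sense of ≺, leaving room on both sides. -/
theorem Prec.geomMean_right (hM : ∀ p, 0 < M p) (hN : ∀ p, 0 < N p) (h : Prec M N) :
    Prec M (geomMean M N) := by
  intro l hl
  obtain ⟨C, hC, hle⟩ := h (l ^ 2) (by positivity)
  refine ⟨√C, Real.sqrt_pos.2 hC, fun p => ?_⟩
  have hm := hM p
  have hn := hN p
  rw [geomMean]
  refine (sq_le_sq₀ (by positivity) (by positivity)).1 ?_
  rw [mul_pow, mul_pow, Real.sq_sqrt hC.le, Real.sq_sqrt (by positivity)]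
  calc M p ^ 2 = M p * M p := sq _
    _ ≤ M p * (C * (l ^ 2) ^ p * N p) := mul_le_mul_of_nonneg_left (hle p) hm.le
    _ = _ := by ring

theorem Prec.geomMean_left (hM : ∀ p, 0 < M p) (hN : ∀ p, 0 < N p) (h : Prec M N) :
    Prec (geomMean M N) N := by
  intro l hl
  obtain ⟨C, hC, hle⟩ := h (l ^ 2) (by positivity)
  refine ⟨√C, Real.sqrt_pos.2 hC, fun p => ?_⟩
  have hm := hM p
  have hn := hN p
  rw [geomMean]
  refine (sq_le_sq₀ (by positivity) (by positivity)).1 ?_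
  rw [mul_pow, mul_pow, Real.sq_sqrt hC.le, Real.sq_sqrt (by positivity)]
  calc M p * N p ≤ C * (l ^ 2) ^ p * N p * N p := mul_le_mul_of_nonneg_right (hle p) hn.le
    _ = _ := by ring

theorem CondM2'.geomMean (hM : ∀ p, 0 < M p) (hN : ∀ p, 0 < N p) (h : CondM2' M)
    (h' : CondM2' N) : CondM2' (geomMean M N) := by
  obtain ⟨A, H, hA, hH, h⟩ := h
  obtain ⟨A', H', hA', hH', h'⟩ := h'
  refine ⟨max A A', max H H', le_max_of_le_left hA, le_max_of_le_left hH, fun p => ?_⟩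
  have hm := hM p
  have hn := hN p
  have hm1 := hM (p + 1)
  have hn1 := hN (p + 1)
  have hA0 : 0 < A := by linarith
  have hH0 : 0 < H := by linarith
  have hA0' : 0 < A' := by linarith
  have hH0' : 0 < H' := by linarith
  have e1 : M (p + 1) ≤ max A A' * max H H' ^ p * M p := by
    refine (h p).trans ?_
    gcongr
    · exact le_max_left _ _
    · exact le_max_left _ _
  have e2 : N (p + 1) ≤ max A A' * max H H' ^ p * N p := by
    refine (h' p).trans ?_
    gcongr
    · exact le_max_right _ _
    · exact le_max_right _ _
  have hmax : 0 < max A A' := lt_max_of_lt_left hA0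
  have hmax' : 0 < max H H' := lt_max_of_lt_left hH0
  simp only [UltraImposs.geomMean]
  refine (sq_le_sq₀ (by positivity) (by positivity)).1 ?_
  rw [mul_pow, Real.sq_sqrt (by positivity), Real.sq_sqrt (by positivity)]
  calc M (p + 1) * N (p + 1)
      ≤ (max A A' * max H H' ^ p * M p) * (max A A' * max H H' ^ p * N p) :=
        mul_le_mul e1 e2 hn1.le (by positivity)
    _ = _ := by ring

end GeomMean

/-! ### Coefficient sequences -/

/-- The factor n + 1 is absorbed by 2^n, and the shift from M_{n+1} to M_n costs only the constant
S. -/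
theorem derivSeq_bound {M : ℕ → ℝ} (hM : ∀ p, 0 < M p) {S C L : ℝ}
    (hr : ∀ n, M n ≤ S * M (n + 1)) (hC : 0 < C) (hL : 0 < L) {b : ℕ → ℂ}
    (hb : ∀ n, ‖b n‖ ≤ C * L ^ n / M n) (n : ℕ) :
    ‖derivSeq b n‖ ≤ (C * L * S) * (2 * L) ^ n / M n := by
  have hm := hM n
  have hm1 := hM (n + 1)
  have h1 : ‖((n : ℂ) + 1)‖ = (n : ℝ) + 1 := by
    rw [← Nat.cast_succ, Complex.norm_natCast, Nat.cast_succ]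
  have h2 : (n : ℝ) + 1 ≤ 2 ^ n := by exact_mod_cast Nat.lt_two_pow_self (n := n)
  rw [derivSeq, norm_mul, h1]
  have h3 : C * L ^ (n + 1) / M (n + 1) ≤ C * L * S * L ^ n / M n := by
    rw [div_le_div_iff₀ hm1 hm]
    calc C * L ^ (n + 1) * M n ≤ C * L ^ (n + 1) * (S * M (n + 1)) := by
          gcongr
          exact hr n
      _ = _ := by ring
  calc ((n : ℝ) + 1) * ‖b (n + 1)‖ ≤ 2 ^ n * (C * L * S * L ^ n / M n) :=
        mul_le_mul h2 ((hb _).trans h3) (norm_nonneg _) (by positivity)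
    _ = _ := by
        rw [mul_pow]
        ring

theorem IsUltraSeq.derivSeq {k : Kind} {M : ℕ → ℝ} (hM : ∀ p, 0 < M p) (hM3 : CondM3' M)
    {b : ℕ → ℂ} (hb : IsUltraSeq k M b) : IsUltraSeq k M (derivSeq b) := by
  obtain ⟨S, hS, hr⟩ := hM3.exists_ratio_le hM
  cases k with
  | beurling =>
    obtain ⟨L, hL, C, hC, h⟩ := hb
    exact ⟨2 * L, by positivity, C * L * S, by positivity, derivSeq_bound hM hr hC hL h⟩
  | roumieu =>
    intro L hL
    obtain ⟨C, hC, h⟩ := hb (L / 2) (by positivity)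
    refine ⟨C * (L / 2) * S, by positivity, fun n => ?_⟩
    have := derivSeq_bound hM hr hC (by positivity) h n
    rwa [mul_div_cancel₀ L two_ne_zero] at this

theorem IsUltraSeq.summable {k : Kind} {M : ℕ → ℝ} (hM : ∀ p, 0 < M p) (hM3 : CondM3' M)
    {b : ℕ → ℂ} (hb : IsUltraSeq k M b) (ξ : ℝ) : Summable fun n => b n * (ξ : ℂ) ^ n := by
  have h : ∃ L : ℝ, 0 < L ∧ ∃ C : ℝ, 0 < C ∧ ∀ n, ‖b n‖ ≤ C * L ^ n / M n := by
    cases k with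
    | beurling => exact hb
    | roumieu => exact ⟨1, one_pos, hb 1 one_pos⟩
  obtain ⟨L, hL, C, hC, h⟩ := h
  refine ((hM3.summable_pow_div hM (t := L * (|ξ| + 1)) (by positivity)).mul_left C).of_norm_bounded
    fun n => ?_
  have hm := hM n
  rw [norm_mul, norm_pow, Complex.norm_real, Real.norm_eq_abs]
  calc ‖b n‖ * |ξ| ^ n ≤ (C * L ^ n / M n) * (|ξ| + 1) ^ n := by
        gcongr
        · exact h n
        · linarith
    _ = _ := by
        rw [mul_pow]
        ring

/-- The coefficients of `∑_n ξ^{2n} / Q_{2n}`. -/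
def evenSeq (Q : ℕ → ℝ) : ℕ → ℂ := fun n => if Even n then ((Q n)⁻¹ : ℝ) else 0

theorem norm_evenSeq_le {M Q : ℕ → ℝ} (hM : ∀ p, 0 < M p) (hQ : ∀ p, 0 < Q p) {C l : ℝ}
    (hC : 0 < C) (hl : 0 < l) (h : ∀ p, M p ≤ C * l ^ p * Q p) (n : ℕ) :
    ‖evenSeq Q n‖ ≤ C * l ^ n / M n := by
  have hm := hM n
  have hq := hQ n
  rw [evenSeq]
  split_ifs
  · rw [Complex.norm_real, Real.norm_of_nonneg (inv_pos.2 hq).le, inv_eq_one_div,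
      div_le_div_iff₀ hq hm, one_mul]
    exact h n
  · rw [norm_zero]
    positivity

theorem isUltraSeq_evenSeq_beurling {M Q : ℕ → ℝ} (hM : ∀ p, 0 < M p) (hQ : ∀ p, 0 < Q p)
    (h : WeakPrec M Q) : IsUltraSeq .beurling M (evenSeq Q) := by
  obtain ⟨l, hl, C, hC, h⟩ := h
  exact ⟨l, hl, C, hC, norm_evenSeq_le hM hQ hC hl h⟩

theorem isUltraSeq_evenSeq {M Q : ℕ → ℝ} (k : Kind) (hM : ∀ p, 0 < M p) (hQ : ∀ p, 0 < Q p)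
    (h : Prec M Q) : IsUltraSeq k M (evenSeq Q) := by
  cases k with
  | beurling => exact isUltraSeq_evenSeq_beurling hM hQ h.weakPrec
  | roumieu =>
    intro l hl
    obtain ⟨C, hC, h⟩ := h l hl
    exact ⟨C, hC, norm_evenSeq_le hM hQ hC hl h⟩

/-! ### The inverse of the symbol -/

/-- The restriction of `1 / P` to `s`, where `P(ξ) = ∑_n ξ^{2n} / Q_{2n}`. -/
def invSymb (Q : ℕ → ℝ) (s : Set ℝ) : ℝ → ℂ := s.indicator fun ξ => (symb (evenSeq Q) ξ)⁻¹

section InvSymb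

variable {Q : ℕ → ℝ}

theorem measurable_invSymb (hs : ∀ ξ : ℝ, Summable fun n => evenSeq Q n * (ξ : ℂ) ^ n) {s : Set ℝ}
    (hsm : MeasurableSet s) : Measurable (invSymb Q s) := by
  refine Measurable.indicator (Measurable.inv ?_) hsm
  refine measurable_of_tendsto_metrizable
    (f := fun N (ξ : ℝ) => ∑ n ∈ Finset.range N, evenSeq Q n * (ξ : ℂ) ^ n) (fun N => ?_)
    (tendsto_pi_nhds.2 fun ξ => (hs ξ).hasSum.tendsto_sum_nat)
  fun_prop

/-- For real ξ the symbol is a sum of nonnegative terms, since only even powers with positive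
coefficients occur; so it dominates each of them, and the constant term excludes real zeros. -/
theorem pow_le_mul_norm_symb (hQ : ∀ p, 0 < Q p)
    (hs : ∀ ξ : ℝ, Summable fun n => evenSeq Q n * (ξ : ℂ) ^ n) (ξ : ℝ) {m : ℕ} (hm : Even m) :
    |ξ| ^ m ≤ Q m * ‖symb (evenSeq Q) ξ‖ := by
  set a : ℕ → ℝ := fun n => if Even n then (Q n)⁻¹ * ξ ^ n else 0 with ha
  have e : ∀ n, evenSeq Q n * (ξ : ℂ) ^ n = (a n : ℂ) := by
    intro n
    simp only [evenSeq, ha]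
    split_ifs <;> simp
  have hnn : ∀ n, 0 ≤ a n := by
    intro n
    simp only [ha]
    split_ifs with h
    · exact mul_nonneg (inv_pos.2 (hQ n)).le (h.pow_nonneg ξ)
    · exact le_rfl
  have hsum : Summable a := by
    have := hs ξ
    simp only [e] at this
    exact Complex.summable_ofReal.1 this
  have hsymb : symb (evenSeq Q) ξ = ((∑' n, a n : ℝ) : ℂ) := by
    rw [symb, Complex.ofReal_tsum]
    exact tsum_congr e
  rw [hsymb, Complex.norm_real, Real.norm_of_nonneg (tsum_nonneg hnn), hm.pow_abs]
  have h1 := hsum.le_tsum m fun j _ => hnn j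
  simp only [ha, if_pos hm] at h1
  rw [inv_mul_le_iff₀ (hQ m)] at h1
  exact h1

theorem symb_ne_zero (hQ : ∀ p, 0 < Q p)
    (hs : ∀ ξ : ℝ, Summable fun n => evenSeq Q n * (ξ : ℂ) ^ n) (ξ : ℝ) :
    symb (evenSeq Q) ξ ≠ 0 := by
  intro h
  have := pow_le_mul_norm_symb hQ hs ξ (m := 0) (by simp)
  rw [h, norm_zero, mul_zero, pow_zero] at this
  linarith

theorem moment_le (hQ : ∀ p, 0 < Q p)
    (hs : ∀ ξ : ℝ, Summable fun n => evenSeq Q n * (ξ : ℂ) ^ n) (s : Set ℝ) (n : ℕ) (ξ : ℝ) :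
    |ξ| ^ n * ‖invSymb Q s ξ‖ ≤ 2 * (Q 0 + Q (n + 2) + Q (n + 3)) * (1 + ξ ^ 2)⁻¹ := by
  have hpos : 0 < ‖symb (evenSeq Q) ξ‖ := norm_pos_iff.2 (symb_ne_zero hQ hs ξ)
  have h1 : ‖invSymb Q s ξ‖ ≤ ‖symb (evenSeq Q) ξ‖⁻¹ := by
    rw [← norm_inv]
    exact norm_indicator_le_norm_self _ _
  have hq0 := hQ 0
  have hq2 := hQ (n + 2)
  have hq3 := hQ (n + 3)
  -- Two powers beyond n pay for the integrable factor 1 / (1 + ξ²); a third may be needed because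
  -- only even powers are available.
  obtain ⟨m, hm, hmn, hmQ⟩ : ∃ m, Even m ∧ n + 2 ≤ m ∧ Q m ≤ Q (n + 2) + Q (n + 3) := by
    rcases Nat.even_or_odd n with h | h
    · exact ⟨n + 2, h.add (by decide), le_rfl, by linarith⟩
    · exact ⟨n + 3, h.add_odd (by decide), by omega, by linarith⟩
  have h0 := pow_le_mul_norm_symb hQ hs ξ (m := 0) (by simp)
  rw [pow_zero] at h0
  have hm' := pow_le_mul_norm_symb hQ hs ξ hm
  have key : |ξ| ^ n * (1 + ξ ^ 2) ≤ 2 * (1 + |ξ| ^ m) := by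
    have ha := abs_nonneg ξ
    rw [← sq_abs ξ]
    rcases le_total |ξ| 1 with h | h
    · have e1 : |ξ| ^ n ≤ 1 := pow_le_one₀ ha h
      have e2 : |ξ| ^ 2 ≤ 1 := pow_le_one₀ ha h
      have e3 : 0 ≤ |ξ| ^ m := by positivity
      calc |ξ| ^ n * (1 + |ξ| ^ 2) ≤ 1 * (1 + 1) := by gcongr
        _ ≤ _ := by linarith
    · have e1 : |ξ| ^ n ≤ |ξ| ^ m := pow_le_pow_right₀ h (by omega)
      have e2 : |ξ| ^ (n + 2) ≤ |ξ| ^ m := pow_le_pow_right₀ h hmn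
      rw [pow_add] at e2
      linarith
  rw [← div_eq_mul_inv, le_div_iff₀ (by positivity)]
  calc |ξ| ^ n * ‖invSymb Q s ξ‖ * (1 + ξ ^ 2)
      ≤ |ξ| ^ n * ‖symb (evenSeq Q) ξ‖⁻¹ * (1 + ξ ^ 2) := by gcongr
    _ = |ξ| ^ n * (1 + ξ ^ 2) * ‖symb (evenSeq Q) ξ‖⁻¹ := by ring
    _ ≤ 2 * (1 + |ξ| ^ m) * ‖symb (evenSeq Q) ξ‖⁻¹ := by gcongr
    _ ≤ 2 * (Q 0 * ‖symb (evenSeq Q) ξ‖ + Q m * ‖symb (evenSeq Q) ξ‖) *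
          ‖symb (evenSeq Q) ξ‖⁻¹ := by gcongr
    _ = 2 * (Q 0 + Q m) := by field_simp
    _ ≤ _ := by linarith

theorem integrable_moment_invSymb (hQ : ∀ p, 0 < Q p)
    (hs : ∀ ξ : ℝ, Summable fun n => evenSeq Q n * (ξ : ℂ) ^ n) {s : Set ℝ}
    (hsm : MeasurableSet s) (n : ℕ) : Integrable fun ξ : ℝ => (ξ : ℂ) ^ n * invSymb Q s ξ := by
  refine (integrable_inv_one_add_sq.const_mul (2 * (Q 0 + Q (n + 2) + Q (n + 3)))).mono' ?_
    (Eventually.of_forall fun ξ => ?_)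
  · have := measurable_invSymb hs hsm
    exact Measurable.aestronglyMeasurable (by fun_prop)
  · rw [norm_mul, norm_pow, Complex.norm_real, Real.norm_eq_abs]
    exact moment_le hQ hs s n ξ

theorem norm_waveInt_invSymb_le (hQ : ∀ p, 0 < Q p)
    (hs : ∀ ξ : ℝ, Summable fun n => evenSeq Q n * (ξ : ℂ) ^ n) {s : Set ℝ}
    (hsm : MeasurableSet s) (i : Fin d) (c : ℝ) (n : ℕ) (x : RSp d) :
    ‖waveInt i c (invSymb Q s) n x‖ ≤ 2 * Real.pi * (Q 0 + Q (n + 2) + Q (n + 3)) := by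
  refine (norm_waveInt_le i c _ n x).trans ?_
  calc ∫ ξ : ℝ, |ξ| ^ n * ‖invSymb Q s ξ‖
      ≤ ∫ ξ : ℝ, 2 * (Q 0 + Q (n + 2) + Q (n + 3)) * (1 + ξ ^ 2)⁻¹ := by
        refine integral_mono ?_ (integrable_inv_one_add_sq.const_mul _)
          fun ξ => moment_le hQ hs s n ξ
        refine (integrable_moment_invSymb hQ hs hsm n).norm.congr (Eventually.of_forall fun ξ => ?_)
        simp only [norm_mul, norm_pow, Complex.norm_real, Real.norm_eq_abs]
    _ = _ := by
        rw [integral_const_mul, integral_univ_inv_one_add_sq]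
        ring

end InvSymb

/-! ### Ultradifferentiable functions of one variable -/

theorem contDiff_of_single (i : Fin d) {g : ℕ → RSp d → ℂ}
    (hg : ∀ n x, HasFDerivAt (g n)
      ((EuclideanSpace.proj i : RSp d →L[ℝ] ℝ).smulRight (g (n + 1) x)) x) :
    ContDiff ℝ ∞ (g 0) := by
  simpa using (isTower_single i hg).contDiff 0

theorem normLE_of_single (i : Fin d) {g : ℕ → RSp d → ℂ}
    (hg : ∀ n x, HasFDerivAt (g n)
      ((EuclideanSpace.proj i : RSp d →L[ℝ] ℝ).smulRight (g (n + 1) x)) x)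
    {N : ℕ → ℝ} (hN : ∀ p, 0 < N p) {h B : ℝ} (hh : 0 < h) (hB : 0 ≤ B) {K : Set (RSp d)}
    (hb : ∀ x ∈ K, ∀ n, ‖g n x‖ ≤ B * (h ^ n * N n)) : NormLE N h K (g 0) B := by
  intro x hx α
  have hT := (isTower_single i hg).mpd_eq α 0
  simp only [Finsupp.coe_zero, Pi.zero_apply, implies_true, if_true, zero_add] at hT
  rw [hT]
  split_ifs with hα
  · have : α.degree = α i := by
      rw [Finsupp.degree_eq_sum]
      exact Finset.sum_eq_single i (fun j _ hj => hα j hj) (by simp)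
    rw [this]
    exact hb x hx _
  · have := hN α.degree
    rw [Pi.zero_apply, norm_zero]
    positivity

/-- `Q` is dominated by `N` in the sense required for a class of kind `k`. -/
def DomBy (k : Kind) (Q N : ℕ → ℝ) : Prop :=
  match k with
  | .beurling => Prec Q N
  | .roumieu => WeakPrec Q N

theorem Prec.domBy {Q N : ℕ → ℝ} (k : Kind) (h : Prec Q N) : DomBy k Q N := by
  cases k with
  | beurling => exact h
  | roumieu => exact h.weakPrec

/-- The n-th derivative is bounded by the n-th absolute moment of 1/P, hence by the shifted values
of Q, which `hshift` returns to h^n Q_n. Domination by N then puts the function into the class of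
kind k; in the Beurling case the arbitrary smallness in ≺ offsets the fixed h. -/
theorem isUltraDiff_waveInt {Q N : ℕ → ℝ} (k : Kind) (hQ : ∀ p, 0 < Q p) (hN : ∀ p, 0 < N p)
    (hs : ∀ ξ : ℝ, Summable fun n => evenSeq Q n * (ξ : ℂ) ^ n) {s : Set ℝ}
    (hsm : MeasurableSet s) (hshift : ∃ B h : ℝ, 0 < B ∧ 0 < h ∧
      ∀ n, Q 0 + Q (n + 2) + Q (n + 3) ≤ B * (h ^ n * Q n))
    (hdom : DomBy k Q N) (Ω : TopologicalSpace.Opens (RSp d)) (i : Fin d) (c : ℝ) :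
    IsUltraDiff k N Ω (waveInt i c (invSymb Q s) 0) := by
  obtain ⟨B, h, hB, hh, hle⟩ := hshift
  have hg := hasFDerivAt_waveInt i c (integrable_moment_invSymb hQ hs hsm)
  have key : ∀ l C : ℝ, 0 < l → 0 < C → (∀ p, Q p ≤ C * l ^ p * N p) → ∀ K : Set (RSp d),
      NormLE N (h * l) K (waveInt i c (invSymb Q s) 0) (2 * Real.pi * (B * C)) := by
    intro l C hl hC hp K
    refine normLE_of_single i hg hN (by positivity) (by positivity) fun x _ n => ?_
    refine (norm_waveInt_invSymb_le hQ hs hsm i c n x).trans ?_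
    calc 2 * Real.pi * (Q 0 + Q (n + 2) + Q (n + 3))
        ≤ 2 * Real.pi * (B * (h ^ n * (C * l ^ n * N n))) := by
          have := (hle n).trans (mul_le_mul_of_nonneg_left
            (mul_le_mul_of_nonneg_left (hp n) (pow_pos hh n).le) hB.le)
          gcongr
      _ = _ := by
          rw [mul_pow]
          ring
  refine ⟨(contDiff_of_single i hg).contDiffOn, fun K _ _ => ?_⟩
  cases k with
  | beurling =>
    intro h' hh'
    obtain ⟨C, hC, hp⟩ := hdom (h' / h) (by positivity)
    have := key (h' / h) C (by positivity) hC hp K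
    rw [mul_div_cancel₀ h' hh.ne'] at this
    exact ⟨_, by positivity, this⟩
  | roumieu =>
    obtain ⟨l, hl, C, hC, hp⟩ := hdom
    exact ⟨h * l, by positivity, _, by positivity, key l C hl hC hp K⟩

/-- The coordinate function `x_i` and its derivatives. -/
def coordTower (i : Fin d) : ℕ → RSp d → ℂ
  | 0 => fun x => ((x i : ℝ) : ℂ)
  | 1 => fun _ => 1
  | _ + 2 => fun _ => 0

theorem hasFDerivAt_coordTower (i : Fin d) (n : ℕ) (x : RSp d) :
    HasFDerivAt (coordTower i n)
      ((EuclideanSpace.proj i : RSp d →L[ℝ] ℝ).smulRight (coordTower i (n + 1) x)) x := by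
  rcases n with _ | _ | n
  · have h := Complex.ofRealCLM.hasFDerivAt.comp x (hasFDerivAt_coord i 0 x)
    have e : coordTower i 0 = Complex.ofRealCLM ∘ fun x : RSp d => x i - 0 := by
      funext y
      simp [coordTower]
    rw [e]
    refine h.congr_fderiv ?_
    ext v
    simp [coordTower]
  · refine (hasFDerivAt_const _ _).congr_fderiv ?_
    ext v
    simp [coordTower]
  · refine (hasFDerivAt_const _ _).congr_fderiv ?_
    ext v
    simp [coordTower]

/-- Only the derivatives of order 0 and 1 are nonzero, so any weight sequence and any h will do.
This makes (P.3) applicable to products with x_i. -/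
theorem isUltraDiff_coord (k : Kind) {N : ℕ → ℝ} (hN : ∀ p, 0 < N p)
    (Ω : TopologicalSpace.Opens (RSp d)) (i : Fin d) :
    IsUltraDiff k N Ω (coordTower i 0) := by
  have hcd := contDiff_of_single i (hasFDerivAt_coordTower i)
  have key : ∀ K : Set (RSp d), IsCompact K → ∀ h : ℝ, 0 < h →
      ∃ B : ℝ, 0 ≤ B ∧ NormLE N h K (coordTower i 0) B := by
    intro K hK h hh
    obtain ⟨R, hR⟩ := hK.exists_bound_of_continuousOn hcd.continuous.continuousOn
    have h0 := hN 0
    have h1 := hN 1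
    refine ⟨|R| / N 0 + 1 / (h * N 1), by positivity,
      normLE_of_single i (hasFDerivAt_coordTower i) hN hh (by positivity) fun x hx n => ?_⟩
    rw [add_mul]
    rcases n with _ | _ | n
    · refine le_add_of_le_of_nonneg ?_ (by positivity)
      rw [pow_zero, one_mul, div_mul_cancel₀ _ h0.ne']
      exact (hR x hx).trans (le_abs_self R)
    · refine le_add_of_nonneg_of_le (by positivity) ?_
      rw [zero_add, pow_one, one_div_mul_cancel (by positivity)]
      simp [coordTower]
    · have := hN (n + 2)
      have e : coordTower i (n + 1 + 1) x = 0 := rfl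
      rw [e, norm_zero]
      positivity
  refine ⟨hcd.contDiffOn, fun K hK _ => ?_⟩
  cases k with
  | beurling => exact fun h hh => key K hK h hh
  | roumieu => exact ⟨1, one_pos, key K hK 1 one_pos⟩

/-! ### Leibniz' rule for a coordinate function -/

theorem polyD_zero (q : MvPolynomial (Fin d) ℂ) : polyD 0 q = q := by
  simp [polyD]

theorem polyD_single (j : Fin d) (q : MvPolynomial (Fin d) ℂ) :
    polyD (Finsupp.single j 1) q = (-Complex.I) • MvPolynomial.pderiv j q := by
  have key : ∀ l : List (Fin d), l.Nodup →
      l.foldr (fun i r => (MvPolynomial.pderiv i)^[Finsupp.single j 1 i] r) q =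
        if j ∈ l then MvPolynomial.pderiv j q else q := by
    intro l hl
    induction l with
    | nil => simp
    | cons a l ih =>
      rw [List.nodup_cons] at hl
      rw [List.foldr_cons, ih hl.2]
      by_cases ha : j = a
      · subst ha
        simp [hl.1]
      · simp [ha]
  rw [polyD, key _ (List.nodup_finRange d), if_pos (List.mem_finRange j)]
  simp

theorem exists_eq_single {β : Fin d →₀ ℕ}
    (hβ : β ∈ Finset.finsuppAntidiag (Finset.univ : Finset (Fin d)) 1) :
    ∃ j, β = Finsupp.single j 1 := by
  rw [Finset.mem_finsuppAntidiag] at hβ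
  have h : β.degree = 1 := by
    rw [Finsupp.degree_eq_sum]
    exact hβ.1
  have h2 : β ≠ 0 := by
    rintro rfl
    simp at h
  obtain ⟨j, hj⟩ := Finsupp.ne_iff.1 h2
  have hsum := hβ.1
  rw [← Finset.add_sum_erase _ _ (Finset.mem_univ j)] at hsum
  rw [Finsupp.zero_apply] at hj
  have hz : ∑ m ∈ Finset.univ.erase j, β m = 0 := by omega
  refine ⟨j, Finsupp.ext fun m => ?_⟩
  by_cases hm : m = j
  · subst hm
    rw [Finsupp.single_eq_same]
    omega
  · rw [Finsupp.single_eq_of_ne hm]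
    exact Finset.sum_eq_zero_iff.1 hz m (Finset.mem_erase.2 ⟨hm, Finset.mem_univ m⟩)

theorem symbolDeriv_zero (a : (Fin d →₀ ℕ) → ℂ) : symbolDeriv 0 a = a := by
  funext α
  simp [symbolDeriv]

theorem symbolDeriv_liftCoeff (i : Fin d) (b : ℕ → ℂ) :
    symbolDeriv (Finsupp.single i 1) (liftCoeff i b) = liftCoeff i (derivSeq b) := by
  funext α
  by_cases h : α = Finsupp.single i (α i)
  · rw [h, liftCoeff_single, symbolDeriv, ← Finsupp.single_add, liftCoeff_single, derivSeq]
    congr 1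
    rw [Finset.prod_eq_single i]
    · simp
    · intro j _ hj
      simp [hj]
    · simp
  · rw [liftCoeff, if_neg h, symbolDeriv, liftCoeff, if_neg, mul_zero]
    intro h'
    rw [Finsupp.add_apply, Finsupp.single_eq_same, Finsupp.single_add] at h'
    exact h (add_right_cancel h')

theorem multiFactorial_zero : multiFactorial (0 : Fin d →₀ ℕ) = 1 := by
  simp [multiFactorial]

theorem multiFactorial_single (i : Fin d) : multiFactorial (Finsupp.single i 1) = 1 := by
  refine Finset.prod_eq_one fun j _ => ?_
  rw [Finsupp.single_apply]
  split_ifs <;> rfl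

section Algebra

variable {k k' : Kind} {M N : PosSeq} {Ω : TopologicalSpace.Opens (RSp d)}

theorem ofPoly_zero : ofPoly k M Ω 0 = 0 := by
  refine Subtype.ext (LinearMap.ext fun φ => ?_)
  change ∫ x in (Ω : Set (RSp d)), polyFun 0 x * φ.1 x = 0
  simp [polyFun]

theorem ofPoly_smul_one (c : ℂ) :
    ofPoly k M Ω (c • 1) = c • ofFun k M Ω (fun _ => 1) continuousOn_const := by
  refine Subtype.ext (LinearMap.ext fun φ => ?_)
  change ∫ x in (Ω : Set (RSp d)), polyFun (c • 1) x * φ.1 x =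
    c * ∫ x in (Ω : Set (RSp d)), 1 * φ.1 x
  rw [← integral_const_mul]
  simp [polyFun]

/-- Leibniz' rule for the product of `x_i` and `f`. -/
theorem IsAdmissible.leibniz_coord {A : Type u} [CommRing A] [Algebra ℂ A]
    {ι : UltraDistr k M Ω →ₗ[ℂ] A} {T : ((Fin d →₀ ℕ) → ℂ) → (A →ₗ[ℂ] A)}
    (hA : IsAdmissible k M k' N Ω A ι T) {b : ℕ → ℂ} (hb : IsUltraSeq k M.1 b) (i : Fin d) (f : A) :
    T (liftCoeff i b) (ι (ofPoly k M Ω (MvPolynomial.X i)) * f) =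
      ι (ofPoly k M Ω (MvPolynomial.X i)) * T (liftCoeff i b) f -
        Complex.I • T (liftCoeff i (derivSeq b)) f := by
  rw [hA.leibniz _ (hb.isUltraOp M.2 i), MvPolynomial.totalDegree_X, Finset.sum_range_succ,
    Finset.sum_range_one, Finset.finsuppAntidiag_zero, Finset.sum_singleton, polyD_zero,
    symbolDeriv_zero, multiFactorial_zero, Finset.sum_eq_single (Finsupp.single i 1)]
  · rw [polyD_single, MvPolynomial.pderiv_X_self, ofPoly_smul_one, map_smul, hA.unity,
      symbolDeriv_liftCoeff, multiFactorial_single, sub_eq_add_neg]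
    simp
  · intro β hβ hne
    obtain ⟨j, rfl⟩ := exists_eq_single hβ
    have hij : i ≠ j := by
      rintro rfl
      exact hne rfl
    rw [polyD_single, MvPolynomial.pderiv_X_of_ne hij, smul_zero, ofPoly_zero, map_zero, zero_mul,
      smul_zero]
  · intro h
    refine absurd ?_ h
    rw [Finset.mem_finsuppAntidiag]
    refine ⟨?_, Finset.subset_univ _⟩
    simp [Finsupp.single_apply]

/-! ### The impossibility result -/

theorem polyFun_X (i : Fin d) : polyFun (MvPolynomial.X i) = coordTower i 0 := by
  funext x
  simp [polyFun, coordTower]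

theorem funLin_apply_eq (g : RSp d → ℂ) (hg : ContinuousOn g Ω) (φ : TestSpace k M Ω) :
    funLin k M Ω g hg φ = ∫ x, g x * φ.1 x := by
  refine setIntegral_eq_integral_of_forall_compl_eq_zero fun x hx => ?_
  rw [image_eq_zero_of_notMem_tsupport fun h => hx (φ.2.2.2 h), mul_zero]

/-! ### Pairings with the weighted superposition of waves. -/

section Symbol

variable {Q : ℕ → ℝ} {s : Set ℝ}

theorem integral_invSymb_mul (hQ : ∀ p, 0 < Q p)
    (hs : ∀ ξ : ℝ, Summable fun n => evenSeq Q n * (ξ : ℂ) ^ n) (hsm : MeasurableSet s)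
    (F : ℝ → ℂ) :
    ∫ ξ, invSymb Q s ξ * (symb (evenSeq Q) ξ * F ξ) = ∫ ξ in s, F ξ := by
  rw [← integral_indicator hsm]
  congr 1
  funext ξ
  by_cases h : ξ ∈ s
  · rw [invSymb, Set.indicator_of_mem h, Set.indicator_of_mem h,
      inv_mul_cancel_left₀ (symb_ne_zero hQ hs ξ)]
  · rw [invSymb, Set.indicator_of_notMem h, Set.indicator_of_notMem h, zero_mul]

theorem integrable_invSymb (hQ : ∀ p, 0 < Q p)
    (hs : ∀ ξ : ℝ, Summable fun n => evenSeq Q n * (ξ : ℂ) ^ n) (hsm : MeasurableSet s) :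
    Integrable (invSymb Q s) := by
  simpa using integrable_moment_invSymb hQ hs hsm 0

/-- The symbol produced by P(-D) cancels the weight 1/P, so P(D)g is the unweighted superposition of
the waves with frequencies in s. -/
theorem integral_waveInt_opSum (hQ : ∀ p, 0 < Q p)
    (hs : ∀ ξ : ℝ, Summable fun n => evenSeq Q n * (ξ : ℂ) ^ n) (hsm : MeasurableSet s)
    (hM2 : CondM2 M.1) (hb : IsUltraSeq k M.1 (evenSeq Q)) (i : Fin d) (c : ℝ)
    (φ : TestSpace k M Ω) :
    ∫ x, waveInt i c (invSymb Q s) 0 x * opSum i (evenSeq Q) φ.1 x = ∫ ξ in s, ft i c φ.1 ξ := by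
  have hψ := opSum_mem hM2 hb i φ
  have hψi : Integrable (opSum i (evenSeq Q) φ.1) :=
    (contDiff_testSpace ⟨_, hψ⟩).continuous.integrable_of_hasCompactSupport hψ.2.1
  rw [integral_waveInt_mul i c (integrable_invSymb hQ hs hsm) hψi]
  simp_rw [ft_opSum hM2 hb i c _ φ]
  exact integral_invSymb_mul hQ hs hsm _

/-- The left side is P(D)(x_i g) + i P'(D) g tested on φ, which is what Leibniz' rule assigns to x_i
∘ P(D)g. On the Fourier side `ft_shiftMul_opSum` collects it into a multiple of P, and 1/P cancels
again. -/
theorem integral_waveInt_commutator (hQ : ∀ p, 0 < Q p)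
    (hs : ∀ ξ : ℝ, Summable fun n => evenSeq Q n * (ξ : ℂ) ^ n) (hsm : MeasurableSet s)
    (hM2 : CondM2 M.1) (hM3 : CondM3' M.1) (hb : IsUltraSeq k M.1 (evenSeq Q)) (i : Fin d) (c : ℝ)
    (φ : TestSpace k M Ω) :
    (∫ x, coordTower i 0 x * waveInt i c (invSymb Q s) 0 x * opSum i (evenSeq Q) φ.1 x) +
      Complex.I * ∫ x, waveInt i c (invSymb Q s) 0 x * opSum i (derivSeq (evenSeq Q)) φ.1 x =
    c * (∫ x, waveInt i c (invSymb Q s) 0 x * opSum i (evenSeq Q) φ.1 x) +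
      ∫ ξ in s, ft i c (shiftMul i c φ.1) ξ := by
  have hb' := hb.derivSeq M.2 hM3
  have hψ := opSum_mem hM2 hb i φ
  have hψ' := opSum_mem hM2 hb' i φ
  have hψs := contDiff_testSpace ⟨_, hψ⟩
  have hψs' := contDiff_testSpace ⟨_, hψ'⟩
  have hsh := contDiff_shiftMul i c hψs
  have hshc := hasCompactSupport_shiftMul i c hψ.2.1
  have hf := integrable_invSymb hQ hs hsm
  have hgc : Continuous (waveInt (d := d) i c (invSymb Q s) 0) :=
    (contDiff_of_single i (hasFDerivAt_waveInt i c
      (integrable_moment_invSymb hQ hs hsm))).continuous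
  have e1 : ∫ x, coordTower i 0 x * waveInt i c (invSymb Q s) 0 x * opSum i (evenSeq Q) φ.1 x =
      (∫ x, waveInt i c (invSymb Q s) 0 x * shiftMul i c (opSum i (evenSeq Q) φ.1) x) +
        c * ∫ x, waveInt i c (invSymb Q s) 0 x * opSum i (evenSeq Q) φ.1 x := by
    rw [← integral_const_mul, ← integral_add]
    · congr 1
      funext x
      simp only [coordTower, shiftMul]
      push_cast
      ring
    · exact (hgc.mul hsh.continuous).integrable_of_hasCompactSupport hshc.mul_left
    · exact ((hgc.mul hψs.continuous).integrable_of_hasCompactSupport hψ.2.1.mul_left).const_mul _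
  have e2 := integral_waveInt_mul i c hf (hsh.continuous.integrable_of_hasCompactSupport hshc)
  have e3 := integral_waveInt_mul i c hf (hψs'.continuous.integrable_of_hasCompactSupport hψ'.2.1)
  have hintg : ∀ {χ : RSp d → ℂ}, ContDiff ℝ ∞ χ → HasCompactSupport χ →
      Integrable fun ξ => invSymb Q s ξ * ft i c χ ξ := by
    intro χ hχ hχc
    have hcont : Continuous (ft i c χ) :=
      continuous_iff_continuousAt.2 fun ξ => (hasDerivAt_ft i c hχ hχc ξ).continuousAt
    simp_rw [mul_comm (invSymb Q s _)]
    exact hf.bdd_mul hcont.aestronglyMeasurable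
      (Eventually.of_forall fun ξ => norm_ft_le i c ξ χ)
  have e4 : (∫ ξ, invSymb Q s ξ * ft i c (shiftMul i c (opSum i (evenSeq Q) φ.1)) ξ) +
      Complex.I * ∫ ξ, invSymb Q s ξ * ft i c (opSum i (derivSeq (evenSeq Q)) φ.1) ξ =
        ∫ ξ in s, ft i c (shiftMul i c φ.1) ξ := by
    rw [← integral_const_mul, ← integral_add (hintg hsh hshc) ((hintg hψs' hψ'.2.1).const_mul _),
      ← integral_invSymb_mul hQ hs hsm]
    congr 1
    funext ξ
    rw [← ft_shiftMul_opSum hM2 hb hb' i c ξ (hs ξ) (hb'.summable M.2 hM3 ξ) φ]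
    ring
  rw [e1, ← e4, e2, e3]
  ring

end Symbol

theorem ft_at_zero (i : Fin d) (c : ℝ) (f : RSp d → ℂ) : ft i c f 0 = ∫ x, f x := by
  simp [ft, wave]

/-- In an admissible algebra `x_i ∘ v = c v + σ`, where `v = P(D) g` and `g` is the superposition
of the waves with frequencies in `s`. -/
theorem IsAdmissible.coord_mul {A : Type u} [CommRing A] [Algebra ℂ A]
    {ι : UltraDistr k M Ω →ₗ[ℂ] A} {T : ((Fin d →₀ ℕ) → ℂ) → (A →ₗ[ℂ] A)}
    (hA : IsAdmissible k M k' N Ω A ι T) (hM2 : CondM2 M.1) (hM3 : CondM3' M.1) {Q : ℕ → ℝ}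
    (hQ : ∀ p, 0 < Q p) (hb : IsUltraSeq k M.1 (evenSeq Q)) (i : Fin d) (c : ℝ) {s : Set ℝ}
    (hsm : MeasurableSet s) (hg : IsUltraDiff k' N.1 Ω (waveInt i c (invSymb Q s) 0)) {σ : ℂ}
    (hσ : ∀ φ : TestSpace k M Ω, ∫ ξ in s, ft i c (shiftMul i c φ.1) ξ = σ * ft i c φ.1 0) :
    ι (ofPoly k M Ω (MvPolynomial.X i)) *
        ι (opDistr hM2 hb i (ofFun k M Ω (waveInt i c (invSymb Q s) 0) hg.1.continuousOn)) =
      (c : ℂ) • ι (opDistr hM2 hb i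
        (ofFun k M Ω (waveInt i c (invSymb Q s) 0) hg.1.continuousOn)) + σ • (1 : A) := by
  have hs := hb.summable M.2 hM3
  have hb' := hb.derivSeq M.2 hM3
  have hX := isUltraDiff_coord k' N.2 Ω i
  set v := ofFun k M Ω (waveInt i c (invSymb Q s) 0) hg.1.continuousOn with hv
  have hXe : ofPoly k M Ω (MvPolynomial.X i) =
      ofFun k M Ω (coordTower i 0) hX.1.continuousOn := by
    simp only [ofPoly, polyFun_X]
  have hprod := hA.product _ _ hX hg
  have h1 := hA.leibniz_coord hb i (ι v)
  set w := ofFun k M Ω (fun x => coordTower i 0 x * waveInt i c (invSymb Q s) 0 x)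
    (hX.1.continuousOn.mul hg.1.continuousOn) with hw
  -- (P.3) replaces x_i ∘ g by the function x_i g, after which every operator acts on an embedded
  -- ultradistribution and is the usual one.
  rw [hXe, hprod, hA.usual _ (hb.isUltraOp M.2 i) _ _ (isUltraOpOf_opDistr hM2 hb i v),
    hA.usual _ (hb.isUltraOp M.2 i) _ _ (isUltraOpOf_opDistr hM2 hb i w),
    hA.usual _ (hb'.isUltraOp M.2 i) _ _ (isUltraOpOf_opDistr hM2 hb' i v)] at h1
  rw [hXe]
  refine (sub_eq_iff_eq_add.1 h1.symm).trans ?_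
  rw [← hA.unity, ← map_smul, ← map_smul, ← map_smul, ← map_add, ← map_add]
  congr 1
  refine Subtype.ext (LinearMap.ext fun φ => ?_)
  have hcomm := integral_waveInt_commutator hQ hs hsm hM2 hM3 hb i c φ
  rw [hσ φ, ft_at_zero] at hcomm
  have hgc := hg.1.continuousOn
  have hc1 : ContinuousOn (fun _ : RSp d => (1 : ℂ)) Ω := continuousOn_const
  change funLin k M Ω _ (hX.1.continuousOn.mul hgc) (opTest hM2 hb i φ) +
      Complex.I * funLin k M Ω _ hgc (opTest hM2 hb' i φ) =
    c * funLin k M Ω _ hgc (opTest hM2 hb i φ) + σ * funLin k M Ω _ hc1 φ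
  simp only [funLin_apply_eq, one_mul]
  exact hcomm

/-- There is no admissible algebra if `Q` is a sequence such that `∑_n D_i^{2n} / Q_{2n}` is an
ultradifferential operator of the first class and `Q` is dominated by the sequence of the second
class. -/
theorem not_existsAlgebra (hM0 : M.1 0 = 1) (hM1 : CondM1 M.1) (hM2 : CondM2 M.1)
    (hM3 : CondM3' M.1) {Q : ℕ → ℝ} (hQ : ∀ p, 0 < Q p) (hMQ : WeakPrec M.1 Q) (hQ2 : CondM2' Q)
    (hb : IsUltraSeq k M.1 (evenSeq Q)) (hdom : DomBy k' Q N.1) (i : Fin d) {y : RSp d}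
    (hy : y ∈ Ω) : ¬ ExistsAlgebra.{u} k M k' N Ω := by
  rintro ⟨A, _, _, ι, T, hA⟩
  have hs := hb.summable M.2 hM3
  have hshift := exists_shift_bound M.2 hQ hM3 hMQ hQ2
  have hg₁ := isUltraDiff_waveInt k' hQ N.2 hs (measurableSet_Ioi (a := (0 : ℝ))) hshift hdom Ω i
    (y i)
  have hg₂ := isUltraDiff_waveInt k' hQ N.2 hs (measurableSet_Iic (a := (0 : ℝ))) hshift hdom Ω i
    (y i)
  have h₁ := hA.coord_mul hM2 hM3 hQ hb i (y i) measurableSet_Ioi hg₁ (σ := Complex.I) fun φ =>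
    integral_Ioi_ft_shiftMul i (y i) (contDiff_testSpace φ) φ.2.2.1
  have h₂ := hA.coord_mul hM2 hM3 hQ hb i (y i) measurableSet_Iic hg₂ (σ := -Complex.I) fun φ =>
    integral_Iic_ft_shiftMul i (y i) (contDiff_testSpace φ) φ.2.2.1
  set v₁ := opDistr hM2 hb i (ofFun k M Ω _ hg₁.1.continuousOn) with hv₁
  set v₂ := opDistr hM2 hb i (ofFun k M Ω _ hg₂.1.continuousOn) with hv₂
  -- Evaluate v₁ ∘ x_i ∘ v₂ in two ways: the terms with y_i cancel, and the constants i and -i add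
  -- up instead of cancelling.
  have hsum : Complex.I • (ι v₁ + ι v₂) = 0 := by
    simp only [Algebra.smul_def, mul_one, map_neg] at h₁ h₂ ⊢
    linear_combination ι v₁ * h₂ - ι v₂ * h₁
  rw [smul_eq_zero_iff_right Complex.I_ne_zero, ← map_add, map_eq_zero_iff ι hA.injective] at hsum
  obtain ⟨φ, hφ⟩ := exists_testSpace_integral_ft_ne_zero (M := M) k hM0 hM1 hM3 hy i
  refine hφ ?_
  have hv : v₁.1 φ + v₂.1 φ = 0 := congrArg (fun v : UltraDistr k M Ω => v.1 φ) hsum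
  have e₁ : v₁.1 φ = ∫ ξ in Set.Ioi (0 : ℝ), ft i (y i) φ.1 ξ := by
    rw [← integral_waveInt_opSum hQ hs measurableSet_Ioi hM2 hb i (y i) φ]
    exact funLin_apply_eq _ hg₁.1.continuousOn (opTest hM2 hb i φ)
  have e₂ : v₂.1 φ = ∫ ξ in Set.Iic (0 : ℝ), ft i (y i) φ.1 ξ := by
    rw [← integral_waveInt_opSum hQ hs measurableSet_Iic hM2 hb i (y i) φ]
    exact funLin_apply_eq _ hg₂.1.continuousOn (opTest hM2 hb i φ)
  have hintg := integrable_ft i (y i) (contDiff_testSpace φ) φ.2.2.1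
  -- The two half-lines make up the whole frequency axis, on which φ was chosen to have nonzero
  -- integral.
  rw [← integral_add_compl measurableSet_Ioi hintg, Set.compl_Ioi, ← e₁, ← e₂]
  exact hv

end Algebra

end UltraImposs

end

/-! ### Conclusion: choice of the auxiliary sequence. -/

theorem mainTheorem1 {d : ℕ} (hd : 1 ≤ d)
    (Ω : TopologicalSpace.Opens (EuclideanSpace ℝ (Fin d)))
    (hΩ : (Ω : Set (EuclideanSpace ℝ (Fin d))).Nonempty)
    (M : UltraImposs.PosSeq) (hM0 : M.1 0 = 1)
    (hM1 : UltraImposs.CondM1 M.1) (hM2 : UltraImposs.CondM2 M.1)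
    (hM3 : UltraImposs.CondM3' M.1) :
    (∀ N : UltraImposs.PosSeq, UltraImposs.CondM1 N.1 → UltraImposs.CondM2' N.1 →
      UltraImposs.Prec M.1 N.1 → ∀ k k' : UltraImposs.Kind,
        ¬ UltraImposs.ExistsAlgebra.{u} k M k' N Ω) ∧
    ¬ UltraImposs.ExistsAlgebra.{u} UltraImposs.Kind.beurling M UltraImposs.Kind.roumieu M Ω := by
  obtain ⟨y, hy⟩ := hΩ
  refine ⟨fun N _ hN2 hMN k k' => ?_, ?_⟩
  -- Q is the geometric mean: M ≺ Q serves both kinds of operator class, and Q ≺ N both kinds of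
  -- regularity class.
  · have hQ := UltraImposs.geomMean_pos M.2 N.2
    have hMQ := hMN.geomMean_right M.2 N.2
    exact UltraImposs.not_existsAlgebra hM0 hM1 hM2 hM3 hQ hMQ.weakPrec
      ((hM2.condM2' M.2).geomMean M.2 N.2 hN2) (UltraImposs.isUltraSeq_evenSeq k M.2 hQ hMQ)
      ((hMN.geomMean_left M.2 N.2).domBy k') ⟨0, hd⟩ hy
  -- Q = M: a Beurling operator and a Roumieu function each need domination for one scale only, so
  -- reflexivity suffices.
  · exact UltraImposs.not_existsAlgebra hM0 hM1 hM2 hM3 M.2 (UltraImposs.WeakPrec.refl _)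
      (hM2.condM2' M.2)
      (UltraImposs.isUltraSeq_evenSeq_beurling M.2 M.2 (UltraImposs.WeakPrec.refl _))
      (UltraImposs.WeakPrec.refl _) ⟨0, hd⟩ hy
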